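/- Let $g \ge 1$ be an integer and let $X_g$ be the hyperelliptic curve $y^2 = x^{2g+1} + 1$ over $\mathbb{C}$, that is, the affine curve $\{(x,y) \in \mathbb{C}^2 : y^2 = x^{2g+1}+1\}$ completed by its single point at infinity $(\infty,\infty)$, near which a local coordinate $\varepsilon$ is given by $x = \varepsilon^{-2}$, $y = \varepsilon^{-(2g+1)}\sqrt{1+\varepsilon^{2(2g+1)}}$. Let $\beta : X_g \to \mathbb{P}^1(\mathbb{C})$ be the map $\beta = (y+1)/2$, with $\beta(\infty,\infty) = \infty$. Then: 1. $(X_g, \beta)$ is a Belyi pair: $X_g$ is a compact connected Riemann surface, and $\beta$ is a surjective holomorphic map that is unramified outside $\beta^{-1}(\{0,1,\infty\})$. 2. $X_g$ has genus $g$, i.e. its space of holomorphic $1$-forms has dimension $g$. 3. $\beta$ has degree $2g+1$: each fibre of $\beta$ is finite and has $2g+1$ points counted with ramification index. 4. $\beta^{-1}(0) = \{(0,-1)\}$, $\beta^{-1}(1) = \{(0,1)\}$ and $\beta^{-1}(\infty) = \{(\infty,\infty)\}$, and $\beta$ has ramification index $2g+1$ at each of these three points. Hence the passport of $\beta$ (the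 multisets of ramification indices over $0$, $1$ and $\infty$) is $\{2g+1;\ 2g+1;\ 2g+1\}$. In particular, this holds for $g = 1$ ($y^2 = x^3+1$) and for $g = 2$ ($y^2 = x^5+1$). -/

import Mathlib

open Set Filter Topology
open scoped Manifold ContDiff

/-! ### Maps of Riemann surfaces to the Riemann sphere -/

/-- The coordinate `z` on `ℂ ⊆ ℙ¹`. -/
noncomputable def sphereChartCoe : OpenPartialHomeomorph (OnePoint ℂ) ℂ :=
  (OpenPartialHomeomorph.refl ℂ).lift_openEmbedding OnePoint.isOpenEmbedding_coe

/-- The coordinate `1/z` on `ℙ¹ ∖ {0}`, with value `0` at `∞`. -/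
noncomputable def sphereChartInfty : OpenPartialHomeomorph (OnePoint ℂ) ℂ where
  toFun p := p.elim 0 (fun z => z⁻¹)
  invFun w := if w = 0 then OnePoint.infty else ((w⁻¹ : ℂ) : OnePoint ℂ)
  source := {((0 : ℂ) : OnePoint ℂ)}ᶜ
  target := univ
  map_source' _ _ := mem_univ _
  map_target' w _ := by
    by_cases hw : w = 0
    · simp [hw]
    · simp [hw, OnePoint.some_eq_iff]
  left_inv' p hp := by
    induction p using OnePoint.rec with
    | infty => simp
    | coe z =>
      have hz : z ≠ 0 := fun h => hp (by simp [h])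
      simp [hz]
  right_inv' w _ := by
    by_cases hw : w = 0 <;> simp [hw]
  open_source := isOpen_compl_singleton
  open_target := isOpen_univ
  continuousOn_toFun := by
    intro p hp
    refine ContinuousAt.continuousWithinAt ?_
    induction p using OnePoint.rec with
    | infty =>
      rw [OnePoint.continuousAt_infty', coclosedCompact_eq_cocompact]
      exact tendsto_inv₀_cobounded.comp (by rw [Metric.cobounded_eq_cocompact]; exact tendsto_id)
    | coe z =>
      have hz : z ≠ 0 := fun h => hp (by simp [h])
      rw [OnePoint.continuousAt_coe]
      exact continuousAt_inv₀ hz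
  continuousOn_invFun := by
    intro w _
    refine ContinuousAt.continuousWithinAt ?_
    by_cases hw : w = 0
    · subst hw
      rw [continuousAt_iff_punctured_nhds]
      have h1 : Tendsto (fun w : ℂ => ((w⁻¹ : ℂ) : OnePoint ℂ)) (𝓝[≠] 0) (𝓝 OnePoint.infty) := by
        refine OnePoint.tendsto_coe_infty.comp ?_
        rw [coclosedCompact_eq_cocompact, ← Metric.cobounded_eq_cocompact]
        exact tendsto_inv₀_nhdsNE_zero
      simp only [if_true]
      refine h1.congr' ?_
      filter_upwards [self_mem_nhdsWithin] with w hw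
      rw [if_neg (by simpa using hw)]
    · have h1 : ContinuousAt (fun w : ℂ => ((w⁻¹ : ℂ) : OnePoint ℂ)) w :=
        OnePoint.continuous_coe.continuousAt.comp (continuousAt_inv₀ hw)
      refine h1.congr ?_
      filter_upwards [isOpen_ne.mem_nhds hw] with v hv
      rw [if_neg hv]

/-- The Riemann sphere `ℙ¹ = ℂ ∪ {∞}` with its two standard charts `z` and `1/z`. -/
noncomputable instance riemannSphereChartedSpace : ChartedSpace ℂ (OnePoint ℂ) where
  atlas := {sphereChartCoe, sphereChartInfty}
  chartAt p := p.elim sphereChartInfty (fun _ => sphereChartCoe)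
  mem_chart_source p := by
    induction p using OnePoint.rec with
    | infty => simp [sphereChartInfty]
    | coe z => simp [sphereChartCoe]
  chart_mem_atlas p := by
    induction p using OnePoint.rec with
    | infty => simp
    | coe z => simp

section RiemannSurface

/-- The ramification index of `β` at `p`: the order of vanishing at `p` of `β - β(p)`, written in
the charts around `p` and `β p`. -/
noncomputable def ramificationIndex {X : Type*} [TopologicalSpace X] [ChartedSpace ℂ X]
    (β : X → OnePoint ℂ) (p : X) : ℕ :=
  analyticOrderNatAt
    (fun z : ℂ => chartAt ℂ (β p) (β ((chartAt ℂ p).symm z)) - chartAt ℂ (β p) (β p))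
    (chartAt ℂ p p)

/-- `β` has degree `d`: every fibre is finite and has `d` points, counted with ramification
index. -/
def HasDegree {X : Type*} [TopologicalSpace X] [ChartedSpace ℂ X]
    (β : X → OnePoint ℂ) (d : ℕ) : Prop :=
  ∀ q : OnePoint ℂ, (β ⁻¹' {q}).Finite ∧ ∑ᶠ p ∈ β ⁻¹' {q}, ramificationIndex β p = d

open Classical in
/-- The multiset of ramification indices of the points over `q` (for a finite fibre). -/
noncomputable def ramificationOver {X : Type*} [TopologicalSpace X] [ChartedSpace ℂ X]
    (β : X → OnePoint ℂ) (q : OnePoint ℂ) : Multiset ℕ :=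
  if h : (β ⁻¹' {q}).Finite then h.toFinset.val.map (ramificationIndex β) else 0

/-- The passport (ramification structure) of `β`: the multisets of ramification indices over
`0`, `1` and `∞`. -/
noncomputable def passport {X : Type*} [TopologicalSpace X] [ChartedSpace ℂ X]
    (β : X → OnePoint ℂ) : Multiset ℕ × Multiset ℕ × Multiset ℕ :=
  (ramificationOver β ((0 : ℂ) : OnePoint ℂ), ramificationOver β ((1 : ℂ) : OnePoint ℂ),
    ramificationOver β OnePoint.infty)

/-- `(X, β)` is a Belyi pair: `X` is a compact Riemann surface and `β : X → ℙ¹` is a surjective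
holomorphic map which is ramified at most over `0`, `1` and `∞`. -/
structure IsBelyiPair (X : Type*) [TopologicalSpace X] [ChartedSpace ℂ X]
    (β : X → OnePoint ℂ) : Prop where
  isManifold : IsManifold 𝓘(ℂ) ω X
  t2Space : T2Space X
  compactSpace : CompactSpace X
  connectedSpace : ConnectedSpace X
  holomorphic : MDifferentiable 𝓘(ℂ) 𝓘(ℂ) β
  surjective : Function.Surjective β
  unramified : ∀ p : X, β p ≠ ((0 : ℂ) : OnePoint ℂ) → β p ≠ ((1 : ℂ) : OnePoint ℂ) → β p ≠ OnePoint.infty →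
    ramificationIndex β p = 1

/-- The holomorphic 1-forms on a Riemann surface `X`. A form is given by its coefficients: it is
`η e z dz` in the chart `e`, where `η e` is holomorphic on the target of `e` (and extended by `0`),
and these expressions transform into each other under the changes of charts. -/
def holomorphicOneForms (X : Type*) [TopologicalSpace X] [ChartedSpace ℂ X] :
    Submodule ℂ (atlas ℂ X → ℂ → ℂ) where
  carrier := {η | (∀ e, DifferentiableOn ℂ (η e) e.1.target) ∧
    (∀ e, ∀ z ∉ e.1.target, η e z = 0) ∧
    ∀ e e', ∀ z ∈ (e.1.symm.trans e'.1).source,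
      η e z = η e' (e'.1 (e.1.symm z)) * deriv (fun w => e'.1 (e.1.symm w)) z}
  zero_mem' := by
    refine ⟨fun e => differentiableOn_const 0, fun e z _ => rfl, fun e e' z _ => ?_⟩
    simp
  add_mem' := by
    rintro a b ⟨ha1, ha2, ha3⟩ ⟨hb1, hb2, hb3⟩
    refine ⟨fun e => (ha1 e).add (hb1 e), fun e z hz => ?_, fun e e' z hz => ?_⟩
    · simp [ha2 e z hz, hb2 e z hz]
    · simp only [Pi.add_apply]
      rw [ha3 e e' z hz, hb3 e e' z hz, add_mul]
  smul_mem' := by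
    rintro c a ⟨ha1, ha2, ha3⟩
    refine ⟨fun e => (ha1 e).const_smul c, fun e z hz => ?_, fun e e' z hz => ?_⟩
    · simp [ha2 e z hz]
    · simp only [Pi.smul_apply, smul_eq_mul]
      rw [ha3 e e' z hz, mul_assoc]

/-- The genus of a compact Riemann surface: the dimension of its space of holomorphic 1-forms. -/
noncomputable def genus (X : Type*) [TopologicalSpace X] [ChartedSpace ℂ X] : ℕ :=
  Module.finrank ℂ (holomorphicOneForms X)

end RiemannSurface

/-! ### The curve `y² = x^(2g+1) + 1` -/

/-- The affine curve `y² = x^(2g+1) + 1` in `ℂ²`. -/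
abbrev AffineCurve (g : ℕ) : Type := {p : ℂ × ℂ // p.2 ^ 2 = p.1 ^ (2 * g + 1) + 1}

/-- The hyperelliptic curve `y² = x^(2g+1) + 1`, completed by its one point `∞ = (∞, ∞)`. -/
abbrev HyperellipticCurve (g : ℕ) : Type := OnePoint (AffineCurve g)

/-- The point `(0, -1)`. -/
def ptZeroNegOne (g : ℕ) : AffineCurve g := ⟨(0, -1), by simp⟩

/-- The point `(0, 1)`. -/
def ptZeroOne (g : ℕ) : AffineCurve g := ⟨(0, 1), by simp⟩

/-- The function `β = (y + 1) / 2` on the curve, with `β(∞) = ∞`. -/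
noncomputable def belyiMap (g : ℕ) (p : HyperellipticCurve g) : OnePoint ℂ :=
  p.elim OnePoint.infty (fun q => (((q.1.2 + 1) / 2 : ℂ) : OnePoint ℂ))

/-- The open sector `|arg u| < π / n` (without the negative real axis), on which `u ↦ u ^ n` is
injective, with image the slit plane and inverse the principal `n`-th root. -/
def sector (n : ℕ) : Set ℂ := {u | u ∈ Complex.slitPlane ∧ |u.arg| < Real.pi / n}

theorem isOpen_sector (n : ℕ) : IsOpen (sector n) := by
  have h : ContinuousOn (fun u : ℂ => |u.arg|) Complex.slitPlane := Complex.continuousOn_arg.abs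
  exact h.isOpen_inter_preimage Complex.isOpen_slitPlane isOpen_Iio

theorem root_pow_sector {n : ℕ} (hn : n ≠ 0) {u : ℂ} (hu : u ∈ sector n) :
    (u ^ n) ^ ((n : ℂ)⁻¹) = u :=
  Complex.pow_cpow_nat_inv hn (abs_lt.1 hu.2).1 (abs_lt.1 hu.2).2.le

theorem pow_mem_slitPlane {n : ℕ} (hn : n ≠ 0) {u : ℂ} (hu : u ∈ sector n) :
    u ^ n ∈ Complex.slitPlane := by
  have hu0 : u ≠ 0 := Complex.slitPlane_ne_zero hu.1
  have hn' : (0 : ℝ) < n := by exact_mod_cast Nat.pos_of_ne_zero hn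
  have h1 : |(n : ℝ) * u.arg| < Real.pi := by
    rw [abs_mul, abs_of_pos hn', mul_comm]
    exact (lt_div_iff₀ hn').1 hu.2
  have h2 : u ^ n = Complex.exp (n * Complex.log u) := by
    rw [Complex.exp_nat_mul, Complex.exp_log hu0]
  have h3 : (n * Complex.log u).im = n * u.arg := by
    simp [Complex.log_im]
  rw [Complex.mem_slitPlane_iff_arg]
  refine ⟨?_, pow_ne_zero _ hu0⟩
  rw [h2, Complex.arg_exp, h3, toIocMod_eq_self Real.two_pi_pos |>.2]
  · exact (abs_lt.1 h1).2.ne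
  · constructor
    · exact (abs_lt.1 h1).1
    · linarith [(abs_lt.1 h1).2]

theorem root_mem_sector {n : ℕ} (hn : n ≠ 0) {w : ℂ} (hw : w ∈ Complex.slitPlane) :
    w ^ ((n : ℂ)⁻¹) ∈ sector n := by
  have hw0 : w ≠ 0 := Complex.slitPlane_ne_zero hw
  have hn' : (1 : ℝ) ≤ n := by exact_mod_cast Nat.one_le_iff_ne_zero.2 hn
  have hpi : |w.arg| < Real.pi := by
    rw [Complex.mem_slitPlane_iff_arg] at hw
    exact abs_lt.2 ⟨Complex.neg_pi_lt_arg w, lt_of_le_of_ne (Complex.arg_le_pi w) hw.1⟩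
  have h3 : (Complex.log w * (n : ℂ)⁻¹).im = w.arg / n := by
    rw [← Complex.ofReal_natCast, ← Complex.ofReal_inv, Complex.im_mul_ofReal, Complex.log_im]
    rfl
  have h4 : |w.arg / n| < Real.pi / n := by
    rw [abs_div, abs_of_pos (by linarith : (0 : ℝ) < n)]
    exact div_lt_div_of_pos_right hpi (by linarith)
  have h5 : Real.pi / n ≤ Real.pi := div_le_self Real.pi_pos.le hn'
  have h6 : (w ^ ((n : ℂ)⁻¹)).arg = w.arg / n := by
    rw [Complex.cpow_def_of_ne_zero hw0, Complex.arg_exp, h3,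
      toIocMod_eq_self Real.two_pi_pos |>.2]
    constructor
    · linarith [(abs_lt.1 h4).1]
    · linarith [(abs_lt.1 h4).2]
  refine ⟨?_, by rw [h6]; exact h4⟩
  rw [Complex.mem_slitPlane_iff_arg, h6]
  refine ⟨?_, by simp [Complex.cpow_eq_zero_iff, hw0]⟩
  exact (lt_of_lt_of_le (abs_lt.1 h4).2 h5).ne

theorem continuousOn_root (n : ℕ) :
    ContinuousOn (fun w : ℂ => w ^ ((n : ℂ)⁻¹)) Complex.slitPlane :=
  fun _ hw => (continuousAt_cpow_const hw).continuousWithinAt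

theorem xChart_mem {g : ℕ} {y₀ : ℂ} (h : y₀ ≠ 0) (z : ℂ) :
    (y₀ * ((z ^ (2 * g + 1) + 1) / y₀ ^ 2) ^ (((2 : ℕ) : ℂ)⁻¹)) ^ 2 = z ^ (2 * g + 1) + 1 := by
  rw [mul_pow, Complex.cpow_nat_inv_pow _ two_ne_zero]
  field_simp

theorem yChart_mem {g : ℕ} {x₀ : ℂ} (h : x₀ ≠ 0) (z : ℂ) :
    z ^ 2 = (x₀ * ((z ^ 2 - 1) / x₀ ^ (2 * g + 1)) ^ (((2 * g + 1 : ℕ) : ℂ)⁻¹)) ^ (2 * g + 1)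
      + 1 := by
  rw [mul_pow, Complex.cpow_nat_inv_pow _ (Nat.succ_ne_zero _),
    mul_div_cancel₀ _ (pow_ne_zero _ h), sub_add_cancel]

theorem inftyPoint_mem {g : ℕ} {ε : ℂ} (h : ε ≠ 0) :
    ((1 + ε ^ (2 * (2 * g + 1))) ^ (((2 : ℕ) : ℂ)⁻¹) / ε ^ (2 * g + 1)) ^ 2 =
      ((ε ^ 2)⁻¹) ^ (2 * g + 1) + 1 := by
  rw [div_pow, Complex.cpow_nat_inv_pow _ two_ne_zero, inv_pow, ← pow_mul, ← pow_mul,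
    mul_comm (2 * g + 1) 2, add_div, div_self (pow_ne_zero _ h), one_div]

/-- The coordinate `x` near a point `p = (x₀, y₀)` of the affine curve with `y₀ ≠ 0`. Its inverse
is `y = y₀ ((x^(2g+1) + 1) / y₀²)^(1/2)`. -/
noncomputable def xChart {g : ℕ} (p : AffineCurve g) (hp : p.1.2 ≠ 0) :
    OpenPartialHomeomorph (AffineCurve g) ℂ where
  toFun q := q.1.1
  invFun z := ⟨(z, p.1.2 * ((z ^ (2 * g + 1) + 1) / p.1.2 ^ 2) ^ (((2 : ℕ) : ℂ)⁻¹)),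
    xChart_mem hp z⟩
  source := {q | q.1.2 / p.1.2 ∈ sector 2}
  target := {z | (z ^ (2 * g + 1) + 1) / p.1.2 ^ 2 ∈ Complex.slitPlane}
  map_source' q hq := by
    have h := pow_mem_slitPlane two_ne_zero hq
    rwa [div_pow, q.2] at h
  map_target' z hz := by
    have h := root_mem_sector two_ne_zero hz
    simpa [mul_div_cancel_left₀ _ hp] using h
  left_inv' q hq := by
    have h := root_pow_sector two_ne_zero hq
    rw [div_pow, q.2] at h
    refine Subtype.ext (Prod.ext rfl ?_)
    simp only [h]
    field_simp
  right_inv' z _ := rfl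
  open_source := (isOpen_sector 2).preimage (by fun_prop)
  open_target := Complex.isOpen_slitPlane.preimage (by fun_prop)
  continuousOn_toFun := by fun_prop
  continuousOn_invFun := by
    refine Topology.IsInducing.subtypeVal.continuousOn_iff.2 ?_
    refine (continuousOn_id.prodMk (continuousOn_const.mul ?_))
    exact (continuousOn_root 2).comp (by fun_prop) (fun z hz => hz)

/-- The coordinate `y` near a point `p = (x₀, y₀)` of the affine curve with `x₀ ≠ 0`. Its inverse
is `x = x₀ ((y² - 1) / x₀^(2g+1))^(1/(2g+1))`. -/
noncomputable def yChart {g : ℕ} (p : AffineCurve g) (hp : p.1.1 ≠ 0) :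
    OpenPartialHomeomorph (AffineCurve g) ℂ where
  toFun q := q.1.2
  invFun z := ⟨(p.1.1 * ((z ^ 2 - 1) / p.1.1 ^ (2 * g + 1)) ^ (((2 * g + 1 : ℕ) : ℂ)⁻¹), z),
    yChart_mem hp z⟩
  source := {q | q.1.1 / p.1.1 ∈ sector (2 * g + 1)}
  target := {z | (z ^ 2 - 1) / p.1.1 ^ (2 * g + 1) ∈ Complex.slitPlane}
  map_source' q hq := by
    have h := pow_mem_slitPlane (Nat.succ_ne_zero _) hq
    rwa [div_pow, ← sub_eq_of_eq_add q.2] at h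
  map_target' z hz := by
    have h := root_mem_sector (Nat.succ_ne_zero (2 * g)) hz
    simpa [mul_div_cancel_left₀ _ hp] using h
  left_inv' q hq := by
    have h := root_pow_sector (Nat.succ_ne_zero _) hq
    rw [div_pow, ← sub_eq_of_eq_add q.2] at h
    refine Subtype.ext (Prod.ext ?_ rfl)
    simp only [Nat.succ_eq_add_one] at h
    simp only [h]
    field_simp
  right_inv' z _ := rfl
  open_source := (isOpen_sector _).preimage (by fun_prop)
  open_target := Complex.isOpen_slitPlane.preimage (by fun_prop)
  continuousOn_toFun := by fun_prop
  continuousOn_invFun := by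
    refine Topology.IsInducing.subtypeVal.continuousOn_iff.2 ?_
    refine ContinuousOn.prodMk (continuousOn_const.mul ?_) continuousOn_id
    exact (continuousOn_root (2 * g + 1)).comp (by fun_prop) (fun z hz => hz)

/-- The points of the affine curve with bounded `x` form a compact set. -/
theorem isCompact_norm_le (g : ℕ) (R : ℝ) : IsCompact {q : AffineCurve g | ‖q.1.1‖ ≤ R} := by
  have hcl : IsClosed {p : ℂ × ℂ | p.2 ^ 2 = p.1 ^ (2 * g + 1) + 1} :=
    isClosed_eq (by fun_prop) (by fun_prop)
  have hce : IsClosedEmbedding (Subtype.val : AffineCurve g → ℂ × ℂ) :=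
    hcl.isClosedEmbedding_subtypeVal
  have hK : IsCompact (Metric.closedBall (0 : ℂ) R ×ˢ
      Metric.closedBall (0 : ℂ) (R ^ (2 * g + 1) + 2)) :=
    (isCompact_closedBall _ _).prod (isCompact_closedBall _ _)
  refine (hce.isCompact_preimage hK).of_isClosed_subset
    (isClosed_le (by fun_prop) continuous_const) ?_
  intro q hq
  have hq' : ‖q.1.1‖ ≤ R := hq
  have h1 : ‖q.1.2‖ ^ 2 ≤ R ^ (2 * g + 1) + 1 := by
    rw [← norm_pow, q.2]
    refine (norm_add_le _ _).trans ?_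
    rw [norm_pow, norm_one]
    gcongr
  have h0 : 0 ≤ R ^ (2 * g + 1) := pow_nonneg ((norm_nonneg _).trans hq') _
  refine ⟨by simpa using hq', ?_⟩
  simp only [mem_closedBall_zero_iff]
  nlinarith [norm_nonneg q.1.2]

theorem tendsto_norm_x (g : ℕ) :
    Tendsto (fun q : AffineCurve g => ‖q.1.1‖) (coclosedCompact _) atTop := by
  rw [tendsto_atTop]
  intro R
  have h := (isCompact_norm_le g R)
  have hm : {q : AffineCurve g | ‖q.1.1‖ ≤ R}ᶜ ∈ coclosedCompact (AffineCurve g) :=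
    h.compl_mem_coclosedCompact_of_isClosed (isClosed_le (by fun_prop) continuous_const)
  filter_upwards [hm] with q hq
  have hq' : ¬ ‖q.1.1‖ ≤ R := hq
  exact (not_le.1 hq').le

/-- The function `ε = x^g (1 + x^-(2g+1))^(1/2) / y` on the affine curve. -/
noncomputable def inftyCoord {g : ℕ} (q : AffineCurve g) : ℂ :=
  q.1.1 ^ g * (1 + (q.1.1 ^ (2 * g + 1))⁻¹) ^ (((2 : ℕ) : ℂ)⁻¹) / q.1.2

theorem one_add_mem_slitPlane {w : ℂ} (hw : ‖w‖ < 1) : 1 + w ∈ Complex.slitPlane :=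
  Complex.mem_slitPlane_of_norm_lt_one hw

theorem norm_inv_pow_lt {n : ℕ} (hn : n ≠ 0) {x : ℂ} (hx : 1 < ‖x‖) : ‖(x ^ n)⁻¹‖ < 1 := by
  rw [norm_inv, norm_pow]
  exact inv_lt_one_of_one_lt₀ (one_lt_pow₀ hx hn)

theorem norm_pow_lt {n : ℕ} (hn : n ≠ 0) {x : ℂ} (hx : ‖x‖ < 1) : ‖x ^ n‖ < 1 := by
  rw [norm_pow]
  exact pow_lt_one₀ (norm_nonneg _) hx hn

theorem y_ne_zero {g : ℕ} {q : AffineCurve g} (hq : 1 < ‖q.1.1‖) : q.1.2 ≠ 0 := by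
  intro h
  have hx : q.1.1 ≠ 0 := norm_pos_iff.1 (one_pos.trans hq)
  have h1 := q.2
  rw [h] at h1
  have h2 := Complex.slitPlane_ne_zero
    (one_add_mem_slitPlane (norm_inv_pow_lt (Nat.succ_ne_zero (2 * g)) hq))
  have h3 := pow_ne_zero (2 * g + 1) hx
  apply h2
  simp only [Nat.succ_eq_add_one]
  field_simp
  rw [← h1]
  simp

theorem inftyCoord_sq {g : ℕ} {q : AffineCurve g} (hq : 1 < ‖q.1.1‖) :
    inftyCoord q ^ 2 = (q.1.1)⁻¹ := by
  have hx : q.1.1 ≠ 0 := norm_pos_iff.1 (one_pos.trans hq)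
  have hy := y_ne_zero hq
  have h3 := pow_ne_zero (2 * g + 1) hx
  rw [inftyCoord, div_pow, mul_pow, Complex.cpow_nat_inv_pow _ two_ne_zero]
  have hy2 : q.1.1 ^ (2 * g + 1) + 1 ≠ 0 := by
    rw [← q.2]
    exact pow_ne_zero 2 hy
  rw [q.2]
  field_simp
  ring

/-- The point of the affine curve with coordinates `x = 1/ε²` and
`y = (1 + ε^(2(2g+1)))^(1/2) / ε^(2g+1)`. -/
noncomputable def inftyPoint (g : ℕ) (ε : ℂ) (h : ε ≠ 0) : AffineCurve g :=
  ⟨((ε ^ 2)⁻¹, (1 + ε ^ (2 * (2 * g + 1))) ^ (((2 : ℕ) : ℂ)⁻¹) / ε ^ (2 * g + 1)),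
    inftyPoint_mem h⟩

theorem inftyPoint_inftyCoord {g : ℕ} {q : AffineCurve g} (hq : 1 < ‖q.1.1‖)
    (h : inftyCoord q ≠ 0) : inftyPoint g (inftyCoord q) h = q := by
  have hx : q.1.1 ≠ 0 := norm_pos_iff.1 (one_pos.trans hq)
  have hy := y_ne_zero hq
  have hs := inftyCoord_sq hq
  refine Subtype.ext (Prod.ext ?_ ?_)
  · simp [inftyPoint, hs]
  · simp only [inftyPoint]
    rw [pow_succ (inftyCoord q) (2 * g), pow_mul, pow_mul, hs, inv_pow, inv_pow]
    have h2 := Complex.slitPlane_ne_zero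
      (one_add_mem_slitPlane (norm_inv_pow_lt (Nat.succ_ne_zero (2 * g)) hq))
    rw [inftyCoord]
    have h4 : (1 + (q.1.1 ^ (2 * g + 1))⁻¹) ^ (((2 : ℕ) : ℂ)⁻¹) ≠ 0 := by
      rw [Ne, Complex.cpow_eq_zero_iff]
      exact fun h => h2 h.1
    generalize (1 + (q.1.1 ^ (2 * g + 1))⁻¹) ^ (((2 : ℕ) : ℂ)⁻¹) = s at h4 ⊢
    field_simp

theorem inftyCoord_inftyPoint {g : ℕ} {ε : ℂ} (h : ε ≠ 0) (h1 : ‖ε‖ < 1) :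
    inftyCoord (inftyPoint g ε h) = ε := by
  have h2 := Complex.slitPlane_ne_zero
    (one_add_mem_slitPlane (norm_pow_lt (n := 2 * (2 * g + 1)) (by omega) h1))
  have h4 : (1 + ε ^ (2 * (2 * g + 1))) ^ (((2 : ℕ) : ℂ)⁻¹) ≠ 0 := by
    rw [Ne, Complex.cpow_eq_zero_iff]
    exact fun h => h2 h.1
  simp only [inftyCoord, inftyPoint]
  rw [inv_pow (ε ^ 2) (2 * g + 1), inv_inv, ← pow_mul]
  generalize (1 + ε ^ (2 * (2 * g + 1))) ^ (((2 : ℕ) : ℂ)⁻¹) = s at h4 ⊢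
  have h5 : ε ^ (2 * g) ≠ 0 := pow_ne_zero _ h
  rw [inv_pow, ← pow_mul, pow_succ]
  field_simp

/-- The coordinate `ε` near the point `∞` of the completed curve, in which `x = 1/ε²` and
`y = (1 + ε^(2(2g+1)))^(1/2) / ε^(2g+1)`. -/
noncomputable def inftyChart (g : ℕ) : OpenPartialHomeomorph (HyperellipticCurve g) ℂ where
  toFun p := p.elim 0 inftyCoord
  invFun ε := if h : ε = 0 then OnePoint.infty else (inftyPoint g ε h : AffineCurve g)
  source := {OnePoint.infty} ∪ OnePoint.some '' {q : AffineCurve g | 1 < ‖q.1.1‖}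
  target := Metric.ball 0 1
  map_source' := by
    rintro p (rfl | ⟨q, hq, rfl⟩)
    · simp
    · have hq' : 1 < ‖q.1.1‖ := hq
      simp only [OnePoint.elim_some, mem_ball_zero_iff]
      have h := congrArg norm (inftyCoord_sq hq')
      rw [norm_pow, norm_inv] at h
      have h1 := inv_lt_one_of_one_lt₀ hq'
      rw [← h] at h1
      exact (sq_lt_one_iff₀ (norm_nonneg _)).1 h1
  map_target' ε hε := by
    by_cases h : ε = 0
    · simp [h]
    · rw [dif_neg h]
      refine Or.inr ⟨_, ?_, rfl⟩
      have h1 : ‖ε‖ < 1 := by simpa using hε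
      simp only [inftyPoint, mem_ofPred_eq, norm_inv, norm_pow]
      exact (one_lt_inv₀ (by positivity)).2 (pow_lt_one₀ (norm_nonneg _) h1 two_ne_zero)
  left_inv' := by
    rintro p (rfl | ⟨q, hq, rfl⟩)
    · simp
    · have hq' : 1 < ‖q.1.1‖ := hq
      have hx : q.1.1 ≠ 0 := norm_pos_iff.1 (one_pos.trans hq')
      have h0 : inftyCoord q ≠ 0 := by
        intro h
        have := inftyCoord_sq hq'
        rw [h] at this
        simp [hx, eq_comm] at this
      refine (dif_neg h0).trans ?_
      exact congrArg OnePoint.some (inftyPoint_inftyCoord hq' h0)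
  right_inv' ε hε := by
    by_cases h : ε = 0
    · simp [h]
    · rw [dif_neg h]
      exact inftyCoord_inftyPoint h (by simpa using hε)
  open_source := by
    have h : ({OnePoint.infty} ∪ OnePoint.some '' {q : AffineCurve g | 1 < ‖q.1.1‖} :
        Set (HyperellipticCurve g)) = (OnePoint.some '' {q : AffineCurve g | ‖q.1.1‖ ≤ 1})ᶜ := by
      rw [OnePoint.compl_image_coe, union_comm]
      congr 2
      ext q
      simp
    rw [h, OnePoint.isOpen_compl_image_coe]
    exact ⟨isClosed_le (by fun_prop) continuous_const, isCompact_norm_le g 1⟩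
  open_target := Metric.isOpen_ball
  continuousOn_toFun := by
    rintro p (rfl | ⟨q, hq, rfl⟩)
    · refine ContinuousAt.continuousWithinAt ?_
      rw [OnePoint.continuousAt_infty']
      have ht := tendsto_norm_x g
      simp only [OnePoint.elim_infty, Function.comp_def, OnePoint.elim_some]
      rw [tendsto_zero_iff_norm_tendsto_zero]
      have h1 : Tendsto (fun q : AffineCurve g => √(‖q.1.1‖⁻¹)) (coclosedCompact _) (𝓝 0) := by
        have := (Real.continuous_sqrt.tendsto 0).comp (tendsto_inv_atTop_zero.comp ht)
        rw [Real.sqrt_zero] at this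
        exact this
      refine h1.congr' ?_
      filter_upwards [ht.eventually_gt_atTop 1] with q hq
      rw [← norm_inv, ← inftyCoord_sq hq, norm_pow, Real.sqrt_sq (norm_nonneg _)]
    · refine ContinuousAt.continuousWithinAt ?_
      have hq' : 1 < ‖q.1.1‖ := hq
      have hx : q.1.1 ≠ 0 := norm_pos_iff.1 (one_pos.trans hq')
      rw [OnePoint.continuousAt_coe]
      have h1 : ContinuousAt (fun q : AffineCurve g => 1 + (q.1.1 ^ (2 * g + 1))⁻¹) q := by
        refine continuousAt_const.add (ContinuousAt.inv₀ (by fun_prop) (pow_ne_zero _ hx))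
      have h2 := ContinuousAt.comp (f := fun q : AffineCurve g => 1 + (q.1.1 ^ (2 * g + 1))⁻¹)
        (continuousAt_cpow_const (b := (((2 : ℕ) : ℂ)⁻¹))
          (one_add_mem_slitPlane (norm_inv_pow_lt (Nat.succ_ne_zero (2 * g)) hq'))) h1
      have h3 : ContinuousAt (fun q : AffineCurve g => q.1.1 ^ g) q := by fun_prop
      have h4 : ContinuousAt (fun q : AffineCurve g => q.1.2) q := by fun_prop
      exact (h3.mul h2).div h4 (y_ne_zero hq')
  continuousOn_invFun := by
    intro ε hε
    refine ContinuousAt.continuousWithinAt ?_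
    by_cases h : ε = 0
    · subst h
      rw [continuousAt_iff_punctured_nhds]
      simp only [dif_pos]
      rw [OnePoint.hasBasis_nhds_infty.tendsto_right_iff]
      rintro s ⟨hs, hs'⟩
      obtain ⟨R, hR⟩ : ∃ R, ∀ q ∈ s, ‖q.1.1‖ ≤ R := by
        obtain ⟨R, hR⟩ := (hs'.image (f := fun q : AffineCurve g => ‖q.1.1‖)
          (by fun_prop)).bddAbove
        exact ⟨R, fun q hq => hR ⟨q, hq, rfl⟩⟩
      have ht : Tendsto (fun ε : ℂ => ‖(ε ^ 2)⁻¹‖) (𝓝[≠] 0) atTop := by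
        have h0 : Tendsto (fun ε : ℂ => ε ^ 2) (𝓝[≠] 0) (𝓝[≠] 0) := by
          refine tendsto_nhdsWithin_iff.2 ⟨?_, ?_⟩
          · have : ContinuousAt (fun ε : ℂ => ε ^ 2) 0 := by fun_prop
            simpa [ContinuousAt] using this.tendsto.mono_left nhdsWithin_le_nhds
          · filter_upwards [self_mem_nhdsWithin] with ε hε
            exact pow_ne_zero 2 hε
        exact tendsto_norm_cobounded_atTop.comp (tendsto_inv₀_nhdsNE_zero.comp h0)
      filter_upwards [ht.eventually_gt_atTop R, self_mem_nhdsWithin] with ε h1 h2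
      rw [dif_neg (show ¬ ε = 0 by simpa using h2)]
      refine Or.inl ⟨_, ?_, rfl⟩
      intro h3
      exact absurd (hR _ h3) (not_le.2 h1)
    · have hε' : ‖ε‖ < 1 := by simpa using hε
      have h2 := one_add_mem_slitPlane (norm_pow_lt (n := 2 * (2 * g + 1)) (by omega) hε')
      rw [← continuousWithinAt_iff_continuousAt (isOpen_ne.mem_nhds h)]
      have key : ContinuousWithinAt (fun ε : ℂ => (((ε ^ 2)⁻¹,
          (1 + ε ^ (2 * (2 * g + 1))) ^ (((2 : ℕ) : ℂ)⁻¹) / ε ^ (2 * g + 1)) : ℂ × ℂ))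
          {ε | ε ≠ 0} ε := by
        refine ContinuousAt.continuousWithinAt (ContinuousAt.prodMk ?_ ?_)
        · exact ContinuousAt.inv₀ (by fun_prop) (pow_ne_zero _ h)
        · refine ContinuousAt.div ?_ (by fun_prop) (pow_ne_zero _ h)
          exact ContinuousAt.comp (f := fun ε : ℂ => 1 + ε ^ (2 * (2 * g + 1)))
            (continuousAt_cpow_const h2) (by fun_prop)
      rw [continuousWithinAt_iff_continuousAt_domRestrict _ h]
      have : Set.domRestrict {ε : ℂ | ε ≠ 0} (fun ε : ℂ =>
          if h : ε = 0 then (OnePoint.infty : HyperellipticCurve g)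
            else (inftyPoint g ε h : AffineCurve g)) =
          fun ε => ((inftyPoint g ε.1 ε.2 : AffineCurve g) : HyperellipticCurve g) := by
        ext1 ε
        simp [dif_neg ε.2]
      rw [this]
      refine OnePoint.continuous_coe.continuousAt.comp ?_
      refine Topology.IsInducing.subtypeVal.continuousAt_iff.2 ?_
      exact (continuousWithinAt_iff_continuousAt_domRestrict _ h).1 key

open Classical in
/-- The preferred chart at a point of the completed curve: `x` where `y ≠ 0`, `y` where `y = 0`
(and hence `x ≠ 0`), and `ε` at `∞`. -/
noncomputable def curveChart (g : ℕ) (p : HyperellipticCurve g) :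
    OpenPartialHomeomorph (HyperellipticCurve g) ℂ :=
  p.elim (inftyChart g) (fun q =>
    if hy : q.1.2 = 0 then
      (yChart q (fun hx => by
        have h := q.2
        simp [hx, hy] at h)).lift_openEmbedding OnePoint.isOpenEmbedding_coe
    else (xChart q hy).lift_openEmbedding OnePoint.isOpenEmbedding_coe)

theorem one_mem_sector {n : ℕ} (hn : n ≠ 0) : (1 : ℂ) ∈ sector n := by
  refine ⟨Complex.one_mem_slitPlane, ?_⟩
  rw [Complex.arg_one, abs_zero]
  have := Real.pi_pos
  positivity

/-- The complex structure of the completed curve `y² = x^(2g+1) + 1`. -/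
noncomputable instance hyperellipticChartedSpace (g : ℕ) :
    ChartedSpace ℂ (HyperellipticCurve g) where
  atlas := range (curveChart g)
  chartAt := curveChart g
  mem_chart_source p := by
    induction p using OnePoint.rec with
    | infty => exact Or.inl rfl
    | coe q =>
      simp only [curveChart, OnePoint.elim_some]
      split_ifs with hy
      · have hx : q.1.1 ≠ 0 := fun hx => by
          have h := q.2
          simp [hx, hy] at h
        refine ⟨q, ?_, rfl⟩
        change q.1.1 / q.1.1 ∈ sector (2 * g + 1)
        rw [div_self hx]
        exact one_mem_sector (Nat.succ_ne_zero _)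
      · refine ⟨q, ?_, rfl⟩
        change q.1.2 / q.1.2 ∈ sector 2
        rw [div_self hy]
        exact one_mem_sector two_ne_zero
  chart_mem_atlas p := mem_range_self p

/-!
The affine curve carries the coordinates `x` and `y`. In every chart both are holomorphic, and every
chart is a holomorphic function of them; the changes of charts are therefore holomorphic
(`differentiableAt_transition`), the one at `∞` being the identity, since only one chart contains
`∞`. The curve is connected because each half `±Re y > 0` is a graph over a star-shaped domain in
the `x`-plane, and the closures of the two halves cover the curve and meet at `(-1, 0)`
(`preconnectedSpace_affineCurve`).

As `2y dy = (2g+1) x^(2g) dx`, the function `y`, and with it `β = (y+1)/2`, is a local coordinate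
wherever `x ≠ 0`. Where `x = 0`, the coordinate is `x`, and `y = ±√(1 + x^(2g+1))` shows that `β` is
ramified to order `2g+1`; at `∞`, `1/β` is `ε^(2g+1)` times a unit. A fibre of `β` over a finite
point is the set of roots of `x^(2g+1) = y² - 1`, which has `2g+1` elements unless `y = ±1`
(`hasDegree_belyiMap`).

For the genus, a holomorphic form `η` is compared with `dx/y`: the ratio `F = η / (dx/y)`
(`formRatio`) is holomorphic on the affine curve, determines `η`, and is `O(|x|^(g-1))` at `∞`
(`exists_norm_formRatio_le`). The sums of `F` and of `y F` over the two points above `x` are entire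
functions of `x` of polynomial growth (`differentiable_trace`), hence polynomials by Liouville's
theorem. The second has degree at most `2g` and vanishes at the `2g+1` branch points, so it is zero
(`trace_y_mul_formRatio`). Hence `F` is invariant under `y ↦ -y`, and is a polynomial in `x` of
degree less than `g`. Conversely the forms `x^k dx/y` with `k < g` are holomorphic
(`monomialForm_mem`), so the space of forms is isomorphic to that of polynomials of degree less
than `g`.
-/

/-! ### The charts of the completed curve -/

section Charts

variable {g : ℕ}

/-- The function `x` on the completed curve, with the junk value `0` at `∞`. -/
def xCoord (p : HyperellipticCurve g) : ℂ := p.elim 0 (fun q => q.1.1)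

/-- The function `y` on the completed curve, with the junk value `0` at `∞`. -/
def yCoord (p : HyperellipticCurve g) : ℂ := p.elim 0 (fun q => q.1.2)

@[simp] theorem xCoord_coe (q : AffineCurve g) : xCoord (q : HyperellipticCurve g) = q.1.1 := rfl

@[simp] theorem yCoord_coe (q : AffineCurve g) : yCoord (q : HyperellipticCurve g) = q.1.2 := rfl

/-- The chart `x` of the affine curve as a chart of the completed curve. -/
noncomputable abbrev xChartExt (p : AffineCurve g) (hp : p.1.2 ≠ 0) :
    OpenPartialHomeomorph (HyperellipticCurve g) ℂ :=
  (xChart p hp).lift_openEmbedding OnePoint.isOpenEmbedding_coe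

/-- The chart `y` of the affine curve as a chart of the completed curve. -/
noncomputable abbrev yChartExt (p : AffineCurve g) (hp : p.1.1 ≠ 0) :
    OpenPartialHomeomorph (HyperellipticCurve g) ℂ :=
  (yChart p hp).lift_openEmbedding OnePoint.isOpenEmbedding_coe

theorem x_ne_zero_of_y_eq_zero {q : AffineCurve g} (hy : q.1.2 = 0) : q.1.1 ≠ 0 := fun hx => by
  have h := q.2
  simp [hx, hy] at h

theorem x_pow_eq (q : AffineCurve g) : q.1.1 ^ (2 * g + 1) = q.1.2 ^ 2 - 1 :=
  (sub_eq_of_eq_add q.2).symm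

theorem chartAt_infty :
    chartAt ℂ (OnePoint.infty : HyperellipticCurve g) = inftyChart g := rfl

theorem chartAt_of_y_ne_zero {q : AffineCurve g} (hy : q.1.2 ≠ 0) :
    chartAt ℂ (q : HyperellipticCurve g) = xChartExt q hy :=
  dif_neg hy

theorem chartAt_of_y_eq_zero {q : AffineCurve g} (hy : q.1.2 = 0) :
    chartAt ℂ (q : HyperellipticCurve g) = yChartExt q (x_ne_zero_of_y_eq_zero hy) :=
  dif_pos hy

theorem atlas_cases {e : OpenPartialHomeomorph (HyperellipticCurve g) ℂ}
    (he : e ∈ atlas ℂ (HyperellipticCurve g)) :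
    (∃ p hp, e = xChartExt p hp) ∨ (∃ p hp, e = yChartExt p hp) ∨ e = inftyChart g := by
  obtain ⟨p, rfl⟩ := he
  induction p using OnePoint.rec with
  | infty => exact Or.inr (Or.inr rfl)
  | coe q =>
    by_cases hy : q.1.2 = 0
    · exact Or.inr (Or.inl ⟨q, x_ne_zero_of_y_eq_zero hy, chartAt_of_y_eq_zero hy⟩)
    · exact Or.inl ⟨q, hy, chartAt_of_y_ne_zero hy⟩

theorem xChartExt_coe (p : AffineCurve g) (hp : p.1.2 ≠ 0) (q : AffineCurve g) :
    xChartExt p hp (q : HyperellipticCurve g) = q.1.1 :=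
  OpenPartialHomeomorph.lift_openEmbedding_apply _ _

theorem yChartExt_coe (p : AffineCurve g) (hp : p.1.1 ≠ 0) (q : AffineCurve g) :
    yChartExt p hp (q : HyperellipticCurve g) = q.1.2 :=
  OpenPartialHomeomorph.lift_openEmbedding_apply _ _

theorem inftyChart_infty : inftyChart g OnePoint.infty = 0 := rfl

theorem inftyChart_symm_zero : (inftyChart g).symm 0 = OnePoint.infty :=
  dif_pos rfl

theorem inftyChart_symm_of_ne {ε : ℂ} (h : ε ≠ 0) :
    (inftyChart g).symm ε = (inftyPoint g ε h : HyperellipticCurve g) :=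
  dif_neg h

theorem xCoord_inftyChart_symm (ε : ℂ) : xCoord ((inftyChart g).symm ε) = (ε ^ 2)⁻¹ := by
  by_cases h : ε = 0
  · subst h
    rw [inftyChart_symm_zero]
    simp [xCoord]
  · rw [inftyChart_symm_of_ne h]
    rfl

theorem yCoord_inftyChart_symm (ε : ℂ) : yCoord ((inftyChart g).symm ε) =
    (1 + ε ^ (2 * (2 * g + 1))) ^ (((2 : ℕ) : ℂ)⁻¹) / ε ^ (2 * g + 1) := by
  by_cases h : ε = 0
  · subst h
    rw [inftyChart_symm_zero]
    simp [yCoord]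
  · rw [inftyChart_symm_of_ne h]
    rfl

theorem infty_notMem_xChartExt_source (p : AffineCurve g) (hp : p.1.2 ≠ 0) :
    OnePoint.infty ∉ (xChartExt p hp).source := by
  rintro ⟨q, -, h⟩
  exact OnePoint.coe_ne_infty q h

theorem infty_notMem_yChartExt_source (p : AffineCurve g) (hp : p.1.1 ≠ 0) :
    OnePoint.infty ∉ (yChartExt p hp).source := by
  rintro ⟨q, -, h⟩
  exact OnePoint.coe_ne_infty q h

/-- The chart at `∞` is the only chart containing `∞`. -/
theorem eq_inftyChart_of_infty_mem {e : OpenPartialHomeomorph (HyperellipticCurve g) ℂ}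
    (he : e ∈ atlas ℂ (HyperellipticCurve g)) (h : OnePoint.infty ∈ e.source) :
    e = inftyChart g := by
  rcases atlas_cases he with ⟨p, hp, rfl⟩ | ⟨p, hp, rfl⟩ | rfl
  · exact absurd h (infty_notMem_xChartExt_source p hp)
  · exact absurd h (infty_notMem_yChartExt_source p hp)
  · rfl

theorem coe_mem_xChartExt_source {p : AffineCurve g} {hp : p.1.2 ≠ 0} {q : AffineCurve g} :
    (q : HyperellipticCurve g) ∈ (xChartExt p hp).source ↔ q.1.2 / p.1.2 ∈ sector 2 :=
  OnePoint.coe_injective.mem_set_image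

theorem coe_mem_yChartExt_source {p : AffineCurve g} {hp : p.1.1 ≠ 0} {q : AffineCurve g} :
    (q : HyperellipticCurve g) ∈ (yChartExt p hp).source ↔ q.1.1 / p.1.1 ∈ sector (2 * g + 1) :=
  OnePoint.coe_injective.mem_set_image

theorem coe_mem_inftyChart_source {q : AffineCurve g} :
    (q : HyperellipticCurve g) ∈ (inftyChart g).source ↔ 1 < ‖q.1.1‖ := by
  refine ⟨?_, fun h => Or.inr ⟨q, h, rfl⟩⟩
  rintro (h | h)
  · exact absurd h (OnePoint.coe_ne_infty q)
  · obtain ⟨r, hr, h⟩ := h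
    exact OnePoint.coe_injective h ▸ hr

theorem y_ne_zero_of_mem_xChartExt_source {p : AffineCurve g} {hp : p.1.2 ≠ 0}
    {q : AffineCurve g} (hq : (q : HyperellipticCurve g) ∈ (xChartExt p hp).source) :
    q.1.2 ≠ 0 := by
  intro h
  have := Complex.slitPlane_ne_zero (coe_mem_xChartExt_source.1 hq).1
  simp [h] at this

theorem x_ne_zero_of_mem_yChartExt_source {p : AffineCurve g} {hp : p.1.1 ≠ 0}
    {q : AffineCurve g} (hq : (q : HyperellipticCurve g) ∈ (yChartExt p hp).source) :
    q.1.1 ≠ 0 := by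
  intro h
  have := Complex.slitPlane_ne_zero (coe_mem_yChartExt_source.1 hq).1
  simp [h] at this

theorem eventually_symm_ne_infty {e : OpenPartialHomeomorph (HyperellipticCurve g) ℂ} {z : ℂ}
    (hz : z ∈ e.target) (h : e.symm z ≠ OnePoint.infty) :
    ∀ᶠ w in 𝓝 z, w ∈ e.target ∧ ∃ q : AffineCurve g, e.symm w = q := by
  have h1 : ∀ᶠ w in 𝓝 z, e.symm w ∈ ({OnePoint.infty}ᶜ : Set (HyperellipticCurve g)) :=
    (e.continuousAt_symm hz).eventually (isOpen_compl_singleton.mem_nhds h)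
  filter_upwards [h1, e.open_target.mem_nhds hz] with w hw hw'
  exact ⟨hw', by simpa [eq_comm] using OnePoint.ne_infty_iff_exists.1 hw⟩

theorem differentiableAt_sqrt_one_add_pow {ε : ℂ} {m : ℕ} (hm : m ≠ 0) (h : ‖ε‖ < 1) :
    DifferentiableAt ℂ (fun ε : ℂ => (1 + ε ^ m) ^ (((2 : ℕ) : ℂ)⁻¹)) ε := by
  refine DifferentiableAt.cpow_const (by fun_prop) (one_add_mem_slitPlane ?_)
  exact norm_pow_lt hm h

theorem differentiableAt_xCoord_symm {e : OpenPartialHomeomorph (HyperellipticCurve g) ℂ}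
    (he : e ∈ atlas ℂ (HyperellipticCurve g)) {z : ℂ} (hz : z ∈ e.target)
    (h : e.symm z ≠ OnePoint.infty) : DifferentiableAt ℂ (fun w => xCoord (e.symm w)) z := by
  rcases atlas_cases he with ⟨p, hp, rfl⟩ | ⟨p, hp, rfl⟩ | rfl
  · exact differentiableAt_id
  · have hz' : (z ^ 2 - 1) / p.1.1 ^ (2 * g + 1) ∈ Complex.slitPlane := hz
    change DifferentiableAt ℂ (fun z : ℂ =>
      p.1.1 * ((z ^ 2 - 1) / p.1.1 ^ (2 * g + 1)) ^ (((2 * g + 1 : ℕ) : ℂ)⁻¹)) z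
    have h1 : DifferentiableAt ℂ (fun z : ℂ => (z ^ 2 - 1) / p.1.1 ^ (2 * g + 1)) z :=
      DifferentiableAt.div_const (by fun_prop) _
    exact (h1.cpow_const hz').const_mul _
  · have h0 : z ≠ 0 := by
      rintro rfl
      exact h inftyChart_symm_zero
    simp only [xCoord_inftyChart_symm]
    exact DifferentiableAt.inv (by fun_prop) (pow_ne_zero _ h0)

theorem differentiableAt_yCoord_symm {e : OpenPartialHomeomorph (HyperellipticCurve g) ℂ}
    (he : e ∈ atlas ℂ (HyperellipticCurve g)) {z : ℂ} (hz : z ∈ e.target)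
    (h : e.symm z ≠ OnePoint.infty) : DifferentiableAt ℂ (fun w => yCoord (e.symm w)) z := by
  rcases atlas_cases he with ⟨p, hp, rfl⟩ | ⟨p, hp, rfl⟩ | rfl
  · have hz' : (z ^ (2 * g + 1) + 1) / p.1.2 ^ 2 ∈ Complex.slitPlane := hz
    change DifferentiableAt ℂ (fun z : ℂ =>
      p.1.2 * ((z ^ (2 * g + 1) + 1) / p.1.2 ^ 2) ^ (((2 : ℕ) : ℂ)⁻¹)) z
    have h1 : DifferentiableAt ℂ (fun z : ℂ => (z ^ (2 * g + 1) + 1) / p.1.2 ^ 2) z :=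
      DifferentiableAt.div_const (by fun_prop) _
    exact (h1.cpow_const hz').const_mul _
  · exact differentiableAt_id
  · have h0 : z ≠ 0 := by
      rintro rfl
      exact h inftyChart_symm_zero
    have hz' : ‖z‖ < 1 := mem_ball_zero_iff.1 hz
    simp only [yCoord_inftyChart_symm]
    exact (differentiableAt_sqrt_one_add_pow (by omega) hz').div (by fun_prop) (pow_ne_zero _ h0)

/-- The changes of charts are holomorphic. -/
theorem differentiableAt_transition {e e' : OpenPartialHomeomorph (HyperellipticCurve g) ℂ}
    (he : e ∈ atlas ℂ (HyperellipticCurve g)) (he' : e' ∈ atlas ℂ (HyperellipticCurve g)) {z : ℂ}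
    (hz : z ∈ (e.symm.trans e').source) : DifferentiableAt ℂ (fun w => e' (e.symm w)) z := by
  have hze : z ∈ e.target := hz.1
  have hze' : e.symm z ∈ e'.source := hz.2
  by_cases h : e.symm z = OnePoint.infty
  · have h1 : e = inftyChart g := eq_inftyChart_of_infty_mem he (h ▸ e.map_target hze)
    have h2 : e' = inftyChart g := eq_inftyChart_of_infty_mem he' (h ▸ hze')
    rw [h2, ← h1]
    refine differentiableAt_id.congr_of_eventuallyEq ?_
    filter_upwards [e.open_target.mem_nhds hze] with w hw
    exact e.right_inv hw
  · have hX := differentiableAt_xCoord_symm he hze h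
    have hY := differentiableAt_yCoord_symm he hze h
    have hev := eventually_symm_ne_infty hze h
    obtain ⟨q, hq⟩ := hev.self_of_nhds.2
    rcases atlas_cases he' with ⟨p, hp, rfl⟩ | ⟨p, hp, rfl⟩ | rfl
    · refine hX.congr_of_eventuallyEq ?_
      filter_upwards [hev] with w hw
      obtain ⟨-, r, hr⟩ := hw
      rw [hr, xChartExt_coe, xCoord_coe]
    · refine hY.congr_of_eventuallyEq ?_
      filter_upwards [hev] with w hw
      obtain ⟨-, r, hr⟩ := hw
      rw [hr, yChartExt_coe, yCoord_coe]
    · rw [hq] at hze'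
      have hq1 := coe_mem_inftyChart_source.1 hze'
      have hx0 : q.1.1 ≠ 0 := norm_pos_iff.1 (one_pos.trans hq1)
      have hXq : xCoord (e.symm z) = q.1.1 := by rw [hq]; rfl
      have hYq : yCoord (e.symm z) = q.1.2 := by rw [hq]; rfl
      have key : DifferentiableAt ℂ (fun w => xCoord (e.symm w) ^ g *
          (1 + (xCoord (e.symm w) ^ (2 * g + 1))⁻¹) ^ (((2 : ℕ) : ℂ)⁻¹) /
            yCoord (e.symm w)) z := by
        refine DifferentiableAt.div ((hX.pow g).mul (DifferentiableAt.cpow_const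
          (((hX.pow _).inv ?_).const_add _) ?_)) hY ?_
        · simpa only [Pi.pow_apply, hXq] using pow_ne_zero _ hx0
        · simpa only [Pi.pow_apply, Pi.inv_apply, hXq] using
            one_add_mem_slitPlane (norm_inv_pow_lt (Nat.succ_ne_zero (2 * g)) hq1)
        · rw [hYq]
          exact y_ne_zero hq1
      refine key.congr_of_eventuallyEq ?_
      filter_upwards [hev] with w hw
      obtain ⟨-, r, hr⟩ := hw
      rw [hr]
      rfl

theorem isManifold_hyperellipticCurve (g : ℕ) :
    IsManifold 𝓘(ℂ) ω (HyperellipticCurve g) := by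
  refine isManifold_of_contDiffOn _ _ _ fun e e' he he' => ?_
  simp only [modelWithCornersSelf_coe, modelWithCornersSelf_coe_symm, preimage_id, range_id,
    inter_univ, Function.comp_id, Function.id_comp]
  refine DifferentiableOn.contDiffOn (fun z hz => ?_) (e.symm.trans e').open_source
  exact (differentiableAt_transition he he' hz).differentiableWithinAt

end Charts

/-! ### Topology of the completed curve -/

section CurveTopology

variable {g : ℕ}

theorem isClosedEmbedding_affineCurve (g : ℕ) :
    IsClosedEmbedding (Subtype.val : AffineCurve g → ℂ × ℂ) :=
  (isClosed_eq (by fun_prop) (by fun_prop) :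
    IsClosed {p : ℂ × ℂ | p.2 ^ 2 = p.1 ^ (2 * g + 1) + 1}).isClosedEmbedding_subtypeVal

theorem t2Space_hyperellipticCurve (g : ℕ) : T2Space (HyperellipticCurve g) := by
  have : LocallyCompactSpace (AffineCurve g) := (isClosedEmbedding_affineCurve g).locallyCompactSpace
  infer_instance

/-- A point of the affine curve over a given `x`; its `y` is the principal square root of
`x^(2g+1) + 1`. -/
noncomputable def sqrtPoint (g : ℕ) (x : ℂ) : AffineCurve g :=
  ⟨(x, (x ^ (2 * g + 1) + 1) ^ (((2 : ℕ) : ℂ)⁻¹)), Complex.cpow_nat_inv_pow _ two_ne_zero⟩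

/-- The hyperelliptic involution `(x, y) ↦ (x, -y)`. -/
def involution (q : AffineCurve g) : AffineCurve g :=
  ⟨(q.1.1, -q.1.2), by rw [neg_sq, q.2]⟩

@[simp] theorem sqrtPoint_x (x : ℂ) : (sqrtPoint g x).1.1 = x := rfl

@[simp] theorem involution_x (q : AffineCurve g) : (involution q).1.1 = q.1.1 := rfl

@[simp] theorem involution_y (q : AffineCurve g) : (involution q).1.2 = -q.1.2 := rfl

theorem involution_involution (q : AffineCurve g) : involution (involution q) = q :=
  Subtype.ext (Prod.ext rfl (neg_neg _))

theorem continuous_involution : Continuous (involution : AffineCurve g → AffineCurve g) :=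
  Continuous.subtype_mk (by fun_prop) _

/-- The fibre of `x` is an orbit of the hyperelliptic involution. -/
theorem eq_or_eq_involution {q r : AffineCurve g} (h : q.1.1 = r.1.1) :
    q = r ∨ q = involution r := by
  have h1 : q.1.2 ^ 2 = r.1.2 ^ 2 := by rw [q.2, r.2, h]
  rcases sq_eq_sq_iff_eq_or_eq_neg.1 h1 with h2 | h2
  · exact Or.inl (Subtype.ext (Prod.ext h h2))
  · exact Or.inr (Subtype.ext (Prod.ext h h2))

theorem noncompactSpace_affineCurve (g : ℕ) : NoncompactSpace (AffineCurve g) := by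
  refine ⟨fun h => ?_⟩
  have h1 : range (fun q : AffineCurve g => q.1.1) = univ :=
    eq_univ_of_forall fun x => ⟨sqrtPoint g x, rfl⟩
  have h2 : IsCompact (univ : Set ℂ) := by
    rw [← h1, ← image_univ]
    exact h.image (by fun_prop)
  exact noncompact_univ ℂ h2

/-- The half `Re y > 0` of the affine curve is the graph of `√(x^(2g+1) + 1)` over a domain which
is star-shaped about `0`. -/
theorem isPreconnected_re_y_pos (g : ℕ) : IsPreconnected {q : AffineCurve g | 0 < q.1.2.re} := by
  have h1 : IsPreconnected {x : ℂ | x ^ (2 * g + 1) + 1 ∈ Complex.slitPlane} := by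
    have hstar : StarConvex ℝ 0 {x : ℂ | x ^ (2 * g + 1) + 1 ∈ Complex.slitPlane} := by
      refine starConvex_zero_iff.2 fun x hx t ht0 ht1 => ?_
      have h2 := starConvex_iff_segment_subset.1 Complex.starConvex_one_slitPlane hx
      refine h2 ⟨1 - t ^ (2 * g + 1), t ^ (2 * g + 1), ?_, by positivity, by ring, ?_⟩
      · exact sub_nonneg.2 (pow_le_one₀ ht0 ht1)
      · simp only [Complex.real_smul]
        push_cast
        ring
    have h0 : (0 : ℂ) ∈ {x : ℂ | x ^ (2 * g + 1) + 1 ∈ Complex.slitPlane} := by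
      rw [mem_ofPred_eq, zero_pow (Nat.succ_ne_zero _), zero_add]
      exact Complex.one_mem_slitPlane
    exact (hstar.isPathConnected h0).isConnected.isPreconnected
  have h2 : {q : AffineCurve g | 0 < q.1.2.re} =
      sqrtPoint g '' {x : ℂ | x ^ (2 * g + 1) + 1 ∈ Complex.slitPlane} := by
    ext q
    constructor
    · intro hq
      have hs : q.1.2 ∈ sector 2 := by
        refine ⟨Complex.mem_slitPlane_iff.2 (Or.inl hq), ?_⟩
        exact_mod_cast Complex.abs_arg_lt_pi_div_two_iff.2 (Or.inl hq)
      refine ⟨q.1.1, ?_, ?_⟩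
      · rw [mem_ofPred_eq, ← q.2]
        exact pow_mem_slitPlane two_ne_zero hs
      · refine Subtype.ext (Prod.ext rfl ?_)
        simp only [sqrtPoint]
        rw [← q.2]
        exact root_pow_sector two_ne_zero hs
    · rintro ⟨x, hx, rfl⟩
      have hs := root_mem_sector two_ne_zero hx
      have h3 := hs.2
      rw [show (((2 : ℕ) : ℝ)) = 2 from rfl, Complex.abs_arg_lt_pi_div_two_iff] at h3
      exact h3.resolve_right (Complex.slitPlane_ne_zero hs.1)
  rw [h2]
  refine h1.image _ (Topology.IsInducing.subtypeVal.continuousOn_iff.2 ?_)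
  refine continuousOn_id.prodMk ?_
  exact (continuousOn_root 2).comp (by fun_prop) (fun z hz => hz)

theorem isPreconnected_re_y_neg (g : ℕ) : IsPreconnected {q : AffineCurve g | q.1.2.re < 0} := by
  have h : {q : AffineCurve g | q.1.2.re < 0} =
      involution '' {q : AffineCurve g | 0 < q.1.2.re} := by
    ext q
    refine ⟨fun hq => ⟨involution q, ?_, involution_involution q⟩, ?_⟩
    · simpa using hq
    · rintro ⟨r, hr, rfl⟩
      simpa using hr
  rw [h]
  exact (isPreconnected_re_y_pos g).image _ continuous_involution.continuousOn

/-- `y` is an open map away from `x = 0`: near `q` every value close to `y(q)` is taken. -/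
theorem mem_closure_of_mem_closure_y {q : AffineCurve g} (hx : q.1.1 ≠ 0) {s : Set ℂ}
    (h : q.1.2 ∈ closure s) : q ∈ closure {r : AffineCurve g | r.1.2 ∈ s} := by
  have hq : q ∈ (yChart q hx).source := by
    change q.1.1 / q.1.1 ∈ sector (2 * g + 1)
    rw [div_self hx]
    exact one_mem_sector (Nat.succ_ne_zero _)
  have hc : ContinuousAt (yChart q hx).symm q.1.2 :=
    (yChart q hx).continuousAt_symm ((yChart q hx).map_source hq)
  have h1 : (yChart q hx).symm q.1.2 = q := (yChart q hx).left_inv hq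
  rw [← h1]
  refine closure_mono ?_ (mem_closure_image hc h)
  rintro _ ⟨z, hz, rfl⟩
  exact hz

theorem preconnectedSpace_affineCurve (g : ℕ) : PreconnectedSpace (AffineCurve g) := by
  have hx : ∀ q : AffineCurve g, q.1.2.re = 0 → q.1.1 ≠ 0 := by
    intro q hq hx
    have h1 := q.2
    rw [hx, zero_pow (Nat.succ_ne_zero _), zero_add] at h1
    rcases sq_eq_one_iff.1 h1 with h | h <;> simp [h] at hq
  have hpos : ∀ q : AffineCurve g, q.1.2.re = 0 → q ∈ closure {q : AffineCurve g | 0 < q.1.2.re} :=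
    fun q hq => mem_closure_of_mem_closure_y (s := {z | 0 < z.re}) (hx q hq) (by
      rw [Complex.closure_setOfPred_lt_re]
      exact hq.ge)
  have hneg : ∀ q : AffineCurve g, q.1.2.re = 0 → q ∈ closure {q : AffineCurve g | q.1.2.re < 0} :=
    fun q hq => mem_closure_of_mem_closure_y (s := {z | z.re < 0}) (hx q hq) (by
      rw [Complex.closure_setOfPred_re_lt]
      exact hq.le)
  -- the two halves `Re y > 0` and `Re y < 0` meet at the branch point `(-1, 0)`
  let b : AffineCurve g := ⟨(-1, 0), by simp [Odd.neg_one_pow (odd_two_mul_add_one g)]⟩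
  have h := (isPreconnected_re_y_pos g).closure.union b (hpos b rfl) (hneg b rfl)
    (isPreconnected_re_y_neg g).closure
  refine ⟨?_⟩
  convert h
  symm
  refine eq_univ_of_forall fun q => ?_
  rcases lt_trichotomy q.1.2.re 0 with hq | hq | hq
  · exact Or.inr (subset_closure hq)
  · exact Or.inl (hpos q hq)
  · exact Or.inl (subset_closure hq)

theorem connectedSpace_hyperellipticCurve (g : ℕ) : ConnectedSpace (HyperellipticCurve g) := by
  have := noncompactSpace_affineCurve g
  have := preconnectedSpace_affineCurve g
  infer_instance

end CurveTopology

/-! ### The Belyi map -/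

section BelyiMap

variable {g : ℕ}

theorem belyiMap_coe (q : AffineCurve g) :
    belyiMap g q = (((q.1.2 + 1) / 2 : ℂ) : OnePoint ℂ) := rfl

theorem belyiMap_infty : belyiMap g OnePoint.infty = OnePoint.infty := rfl

theorem sphereChartCoe_coe (z : ℂ) : sphereChartCoe (z : OnePoint ℂ) = z :=
  OpenPartialHomeomorph.lift_openEmbedding_apply _ _

theorem analyticAt_yCoord_symm {e : OpenPartialHomeomorph (HyperellipticCurve g) ℂ}
    (he : e ∈ atlas ℂ (HyperellipticCurve g)) {z : ℂ} (hz : z ∈ e.target)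
    (h : e.symm z ≠ OnePoint.infty) : AnalyticAt ℂ (fun w => yCoord (e.symm w)) z := by
  rw [Complex.analyticAt_iff_eventually_differentiableAt]
  filter_upwards [eventually_symm_ne_infty hz h] with w hw
  obtain ⟨hw, r, hr⟩ := hw
  exact differentiableAt_yCoord_symm he hw (by simp [hr])

/-- The equation of the curve differentiated in a chart: `2y dy = (2g+1) x^(2g) dx`. -/
theorem two_mul_y_mul_deriv_y {e : OpenPartialHomeomorph (HyperellipticCurve g) ℂ}
    (he : e ∈ atlas ℂ (HyperellipticCurve g)) {z : ℂ} (hz : z ∈ e.target) {q : AffineCurve g}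
    (hq : e.symm z = q) :
    2 * q.1.2 * deriv (fun w => yCoord (e.symm w)) z =
      (2 * g + 1) * q.1.1 ^ (2 * g) * deriv (fun w => xCoord (e.symm w)) z := by
  have h : e.symm z ≠ OnePoint.infty := by simp [hq]
  have hX := (differentiableAt_xCoord_symm he hz h).hasDerivAt
  have hY := (differentiableAt_yCoord_symm he hz h).hasDerivAt
  have h1 := hY.fun_pow 2
  have h2 := (hX.fun_pow (2 * g + 1)).add_const 1
  have h3 : (fun w => yCoord (e.symm w) ^ 2) =ᶠ[𝓝 z]
      fun w => xCoord (e.symm w) ^ (2 * g + 1) + 1 := by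
    filter_upwards [eventually_symm_ne_infty hz h] with w hw
    obtain ⟨-, r, hr⟩ := hw
    simp only [hr, xCoord_coe, yCoord_coe]
    exact r.2
  have h4 := h1.unique (h2.congr_of_eventuallyEq h3)
  simp only [hq, xCoord_coe, yCoord_coe] at h4
  simpa using h4

/-- In the coordinates `ε` and `1/z` the Belyi map is
`ε ↦ 2 ε^(2g+1) / (√(1 + ε^(2(2g+1))) + ε^(2g+1))`. -/
theorem sphereChartInfty_belyiMap_inftyChart_symm (ε : ℂ) :
    sphereChartInfty (belyiMap g ((inftyChart g).symm ε)) =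
      2 * ε ^ (2 * g + 1) / ((1 + ε ^ (2 * (2 * g + 1))) ^ (((2 : ℕ) : ℂ)⁻¹) + ε ^ (2 * g + 1)) := by
  by_cases h : ε = 0
  · subst h
    rw [inftyChart_symm_zero, belyiMap_infty, zero_pow (Nat.succ_ne_zero _), mul_zero, zero_div]
    rfl
  · rw [inftyChart_symm_of_ne h, belyiMap_coe]
    change (((1 + ε ^ (2 * (2 * g + 1))) ^ (((2 : ℕ) : ℂ)⁻¹) / ε ^ (2 * g + 1) + 1) / 2)⁻¹ = _
    rw [div_add_one (pow_ne_zero _ h), div_div, inv_div, mul_comm]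

theorem analyticAt_sqrt_one_add_pow {m : ℕ} (hm : m ≠ 0) :
    AnalyticAt ℂ (fun ε : ℂ => (1 + ε ^ m) ^ (((2 : ℕ) : ℂ)⁻¹)) 0 := by
  rw [Complex.analyticAt_iff_eventually_differentiableAt]
  filter_upwards [Metric.ball_mem_nhds (0 : ℂ) one_pos] with ε hε
  exact differentiableAt_sqrt_one_add_pow hm (mem_ball_zero_iff.1 hε)

theorem sqrt_one_add_zero_pow {m : ℕ} (hm : m ≠ 0) :
    (1 + (0 : ℂ) ^ m) ^ (((2 : ℕ) : ℂ)⁻¹) = 1 := by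
  rw [zero_pow hm, add_zero, Complex.one_cpow]

theorem analyticAt_belyiMap_infty_factor (g : ℕ) :
    AnalyticAt ℂ (fun ε : ℂ =>
      2 / ((1 + ε ^ (2 * (2 * g + 1))) ^ (((2 : ℕ) : ℂ)⁻¹) + ε ^ (2 * g + 1))) 0 := by
  refine analyticAt_const.div ((analyticAt_sqrt_one_add_pow (by omega)).add (by fun_prop)) ?_
  rw [sqrt_one_add_zero_pow (by omega), zero_pow (by omega), add_zero]
  exact one_ne_zero

theorem analyticAt_belyiMap_infty (g : ℕ) :
    AnalyticAt ℂ (fun ε => sphereChartInfty (belyiMap g ((inftyChart g).symm ε))) 0 := by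
  simp only [sphereChartInfty_belyiMap_inftyChart_symm, mul_div_right_comm]
  exact (analyticAt_belyiMap_infty_factor g).mul (by fun_prop)

theorem continuousAt_belyiMap_infty (g : ℕ) :
    ContinuousAt (belyiMap g) OnePoint.infty := by
  have hmem : OnePoint.infty ∈ (inftyChart g).source := Or.inl rfl
  have h1 : ContinuousAt (inftyChart g) OnePoint.infty := (inftyChart g).continuousAt hmem
  have h2 : ContinuousAt (fun p => sphereChartInfty (belyiMap g ((inftyChart g).symm
      (inftyChart g p)))) OnePoint.infty :=
    ContinuousAt.comp (f := inftyChart g)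
      (g := fun ε => sphereChartInfty (belyiMap g ((inftyChart g).symm ε)))
      (analyticAt_belyiMap_infty g).continuousAt h1
  have h3 := ContinuousAt.comp (g := sphereChartInfty.symm)
    (sphereChartInfty.continuousAt_symm (mem_univ _)) h2
  refine h3.congr ?_
  filter_upwards [(inftyChart g).open_source.mem_nhds hmem] with p hp
  rw [Function.comp_apply, (inftyChart g).left_inv hp]
  refine sphereChartInfty.left_inv ?_
  rintro (h : belyiMap g p = ((0 : ℂ) : OnePoint ℂ))
  induction p using OnePoint.rec with
  | infty => exact OnePoint.infty_ne_coe _ h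
  | coe q =>
    -- `β` vanishes only at `y = -1`, where `x = 0`, and the chart at `∞` has `|x| > 1`
    rw [belyiMap_coe, OnePoint.coe_eq_coe] at h
    have hx := coe_mem_inftyChart_source.1 hp
    have hy : q.1.2 = -1 := by linear_combination 2 * h
    have hx0 : q.1.1 ^ (2 * g + 1) = 0 := by rw [x_pow_eq, hy]; ring
    rw [eq_zero_of_pow_eq_zero hx0, norm_zero] at hx
    exact absurd hx (by norm_num)

/-- The Belyi map written in charts near an affine point. -/
theorem sphereChartCoe_belyiMap_eventuallyEq
    {e : OpenPartialHomeomorph (HyperellipticCurve g) ℂ} {z : ℂ}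
    (hz : z ∈ e.target) (h : e.symm z ≠ OnePoint.infty) :
    (fun w => sphereChartCoe (belyiMap g (e.symm w))) =ᶠ[𝓝 z]
      fun w => (yCoord (e.symm w) + 1) / 2 := by
  filter_upwards [eventually_symm_ne_infty hz h] with w hw
  obtain ⟨-, r, hr⟩ := hw
  rw [hr, belyiMap_coe, sphereChartCoe_coe, yCoord_coe]

theorem mdifferentiable_belyiMap (g : ℕ) : MDifferentiable 𝓘(ℂ) 𝓘(ℂ) (belyiMap g) := by
  intro p
  rw [mdifferentiableAt_iff]
  simp only [modelWithCornersSelf_coe, range_id, differentiableWithinAt_univ, extChartAt_coe,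
    writtenInExtChartAt, extChartAt_coe_symm, modelWithCornersSelf_coe_symm, Function.comp_def, id]
  induction p using OnePoint.rec with
  | infty => exact ⟨continuousAt_belyiMap_infty g, (analyticAt_belyiMap_infty g).differentiableAt⟩
  | coe q =>
    constructor
    · rw [OnePoint.continuousAt_coe]
      exact OnePoint.continuous_coe.continuousAt.comp
        (f := fun q : AffineCurve g => (q.1.2 + 1) / 2) (by fun_prop)
    · have he := chart_mem_atlas ℂ (q : HyperellipticCurve g)
      have hz := mem_chart_target ℂ (q : HyperellipticCurve g)
      have h : (chartAt ℂ (q : HyperellipticCurve g)).symm (chartAt ℂ (q : HyperellipticCurve g) q)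
          ≠ OnePoint.infty := by
        rw [(chartAt ℂ (q : HyperellipticCurve g)).left_inv (mem_chart_source ℂ _)]
        exact OnePoint.coe_ne_infty q
      refine DifferentiableAt.congr_of_eventuallyEq ?_
        (sphereChartCoe_belyiMap_eventuallyEq hz h)
      exact ((differentiableAt_yCoord_symm he hz h).add_const 1).div_const 2

theorem analyticOrderNatAt_eq_of_eventuallyEq {f h : ℂ → ℂ} {z₀ : ℂ} {n : ℕ}
    (hh : AnalyticAt ℂ h z₀) (h0 : h z₀ ≠ 0) (hf : f =ᶠ[𝓝 z₀] fun z => (z - z₀) ^ n * h z) :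
    analyticOrderNatAt f z₀ = n := by
  have hfa : AnalyticAt ℂ f z₀ := (AnalyticAt.mul (by fun_prop) hh).congr hf.symm
  have : analyticOrderAt f z₀ = n := hfa.analyticOrderAt_eq_natCast.2 ⟨h, hh, h0, hf⟩
  rw [analyticOrderNatAt, this, ENat.toNat_natCast]

theorem ramificationIndex_infty (g : ℕ) :
    ramificationIndex (belyiMap g) (OnePoint.infty : HyperellipticCurve g) = 2 * g + 1 := by
  refine analyticOrderNatAt_eq_of_eventuallyEq (analyticAt_belyiMap_infty_factor g) ?_ ?_
  · rw [chartAt_infty, inftyChart_infty, sqrt_one_add_zero_pow (by omega), zero_pow (by omega), add_zero, div_one]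
    exact two_ne_zero
  · refine Eventually.of_forall fun ε => ?_
    change sphereChartInfty (belyiMap g ((inftyChart g).symm ε)) - 0 = (ε - 0) ^ _ * _
    rw [sphereChartInfty_belyiMap_inftyChart_symm]
    ring

theorem ramificationIndex_coe (q : AffineCurve g) :
    ramificationIndex (belyiMap g) (q : HyperellipticCurve g) = analyticOrderNatAt
      (fun z => (yCoord ((chartAt ℂ (q : HyperellipticCurve g)).symm z) + 1) / 2 - (q.1.2 + 1) / 2)
      (chartAt ℂ (q : HyperellipticCurve g) q) := by
  have hz := mem_chart_target ℂ (q : HyperellipticCurve g)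
  have h : (chartAt ℂ (q : HyperellipticCurve g)).symm (chartAt ℂ (q : HyperellipticCurve g) q)
      ≠ OnePoint.infty := by
    rw [(chartAt ℂ (q : HyperellipticCurve g)).left_inv (mem_chart_source ℂ _)]
    exact OnePoint.coe_ne_infty q
  refine congrArg ENat.toNat (analyticOrderAt_congr ?_)
  filter_upwards [sphereChartCoe_belyiMap_eventuallyEq hz h] with w hw
  refine congrArg₂ _ hw ?_
  exact sphereChartCoe_coe _

/-- `y` is a local coordinate where `x ≠ 0`. -/
theorem ramificationIndex_of_x_ne_zero {q : AffineCurve g} (hx : q.1.1 ≠ 0) :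
    ramificationIndex (belyiMap g) (q : HyperellipticCurve g) = 1 := by
  have he := chart_mem_atlas ℂ (q : HyperellipticCurve g)
  have hz := mem_chart_target ℂ (q : HyperellipticCurve g)
  have hl := (chartAt ℂ (q : HyperellipticCurve g)).left_inv (mem_chart_source ℂ _)
  have h : (chartAt ℂ (q : HyperellipticCurve g)).symm (chartAt ℂ (q : HyperellipticCurve g) q)
      ≠ OnePoint.infty := by
    rw [hl]
    exact OnePoint.coe_ne_infty q
  have hd : deriv (fun z => yCoord ((chartAt ℂ (q : HyperellipticCurve g)).symm z))
      (chartAt ℂ (q : HyperellipticCurve g) q) ≠ 0 := by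
    by_cases hy : q.1.2 = 0
    · rw [chartAt_of_y_eq_zero hy]
      change deriv (fun z : ℂ => z) _ ≠ 0
      simp
    · have h1 := two_mul_y_mul_deriv_y he hz hl
      have h2 : deriv (fun w => xCoord ((chartAt ℂ (q : HyperellipticCurve g)).symm w))
          (chartAt ℂ (q : HyperellipticCurve g) q) = 1 := by
        rw [chartAt_of_y_ne_zero hy]
        change deriv (fun z : ℂ => z) _ = 1
        simp
      intro h0
      rw [h0, h2, mul_zero, mul_one, eq_comm] at h1
      have h3 : (2 * (g : ℂ) + 1) ≠ 0 := by exact_mod_cast Nat.succ_ne_zero (2 * g)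
      exact mul_ne_zero h3 (pow_ne_zero _ hx) h1
  have hY := analyticAt_yCoord_symm he hz h
  have key := ((hY.add analyticAt_const).div (analyticAt_const (v := (2 : ℂ))) two_ne_zero
    ).analyticOrderAt_sub_eq_one_of_deriv_ne_zero (x := chartAt ℂ (q : HyperellipticCurve g) q)
    (f := fun z => (yCoord ((chartAt ℂ (q : HyperellipticCurve g)).symm z) + 1) / 2) (by
      rw [deriv_div_const, deriv_add_const]
      exact div_ne_zero hd two_ne_zero)
  rw [ramificationIndex_coe, analyticOrderNatAt]
  simp only [hl, yCoord_coe] at key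
  rw [key]
  rfl

/-- Where `x = 0`, `y - y₀ = y₀ (√(1 + x^(2g+1)) - 1)` vanishes to order `2g+1` in `x`. -/
theorem ramificationIndex_of_x_eq_zero {q : AffineCurve g} (hx : q.1.1 = 0) :
    ramificationIndex (belyiMap g) (q : HyperellipticCurve g) = 2 * g + 1 := by
  have hy2 : q.1.2 ^ 2 = 1 := by rw [q.2, hx, zero_pow (Nat.succ_ne_zero _), zero_add]
  have hy : q.1.2 ≠ 0 := by
    intro h
    simp [h] at hy2
  have hs1 : (1 + (0 : ℂ) ^ (2 * g + 1)) ^ (((2 : ℕ) : ℂ)⁻¹) + 1 ≠ 0 := by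
    rw [sqrt_one_add_zero_pow (by omega)]
    norm_num
  have hs : AnalyticAt ℂ (fun z : ℂ => (1 + z ^ (2 * g + 1)) ^ (((2 : ℕ) : ℂ)⁻¹) + 1) 0 :=
    (analyticAt_sqrt_one_add_pow (by omega)).add analyticAt_const
  rw [ramificationIndex_coe, chartAt_of_y_ne_zero hy, xChartExt_coe, hx]
  refine analyticOrderNatAt_eq_of_eventuallyEq
    (h := fun z => q.1.2 / 2 / ((1 + z ^ (2 * g + 1)) ^ (((2 : ℕ) : ℂ)⁻¹) + 1))
    (analyticAt_const.div hs hs1) (div_ne_zero (div_ne_zero hy two_ne_zero) hs1) ?_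
  filter_upwards [hs.continuousAt.eventually_ne hs1] with z hz
  change (q.1.2 * ((z ^ (2 * g + 1) + 1) / q.1.2 ^ 2) ^ (((2 : ℕ) : ℂ)⁻¹) + 1) / 2 -
    (q.1.2 + 1) / 2 = _
  rw [hy2, div_one, sub_zero, add_comm (z ^ (2 * g + 1)) 1]
  have h2 : ((1 + z ^ (2 * g + 1)) ^ (((2 : ℕ) : ℂ)⁻¹)) ^ 2 = 1 + z ^ (2 * g + 1) :=
    Complex.cpow_nat_inv_pow _ two_ne_zero
  generalize (1 + z ^ (2 * g + 1)) ^ (((2 : ℕ) : ℂ)⁻¹) = S at hz h2 ⊢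
  field_simp
  linear_combination q.1.2 * h2

theorem belyiMap_preimage_infty (g : ℕ) :
    belyiMap g ⁻¹' {OnePoint.infty} = {(OnePoint.infty : HyperellipticCurve g)} := by
  ext p
  induction p using OnePoint.rec with
  | infty => simp [belyiMap_infty]
  | coe q => simp [belyiMap_coe]

theorem belyiMap_preimage_coe (g : ℕ) (c : ℂ) :
    belyiMap g ⁻¹' {(c : OnePoint ℂ)} =
      (OnePoint.some '' {q : AffineCurve g | q.1.2 = 2 * c - 1} : Set (HyperellipticCurve g)) := by
  ext p
  induction p using OnePoint.rec with
  | infty => simp [belyiMap_infty]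
  | coe q =>
    rw [OnePoint.coe_injective.mem_set_image, mem_preimage, mem_singleton_iff, belyiMap_coe,
      OnePoint.coe_eq_coe, mem_ofPred_eq]
    constructor <;> intro h
    · linear_combination 2 * h
    · linear_combination h / 2

/-- The fibre of `β` through a point with `x = 0`. -/
theorem belyiMap_preimage_of_x_eq_zero {q : AffineCurve g} (hx : q.1.1 = 0) {c : ℂ}
    (hc : q.1.2 = 2 * c - 1) :
    belyiMap g ⁻¹' {(c : OnePoint ℂ)} = {(q : HyperellipticCurve g)} := by
  rw [belyiMap_preimage_coe, ← image_singleton]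
  congr 1
  ext r
  refine ⟨fun hr => ?_, ?_⟩
  · have hr' : r.1.2 = q.1.2 := Eq.trans hr hc.symm
    refine Subtype.ext (Prod.ext ?_ hr')
    refine Eq.trans (eq_zero_of_pow_eq_zero (n := 2 * g + 1) ?_) hx.symm
    rw [x_pow_eq, hr', ← x_pow_eq, hx, zero_pow (Nat.succ_ne_zero _)]
  · rintro rfl
    exact hc

theorem belyiMap_preimage_zero (g : ℕ) :
    belyiMap g ⁻¹' {((0 : ℂ) : OnePoint ℂ)} = {(ptZeroNegOne g : HyperellipticCurve g)} :=
  belyiMap_preimage_of_x_eq_zero rfl (by simp [ptZeroNegOne])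

theorem belyiMap_preimage_one (g : ℕ) :
    belyiMap g ⁻¹' {((1 : ℂ) : OnePoint ℂ)} = {(ptZeroOne g : HyperellipticCurve g)} :=
  belyiMap_preimage_of_x_eq_zero rfl (by norm_num [ptZeroOne])

theorem ncard_pow_eq {n : ℕ} (hn : n ≠ 0) {a : ℂ} (ha : a ≠ 0) :
    {x : ℂ | x ^ n = a}.ncard = n := by
  have hζ := Complex.isPrimitiveRoot_exp n hn
  have h : {x : ℂ | x ^ n = a} = (Polynomial.nthRoots n a).toFinset := by
    ext x
    simp [Polynomial.mem_nthRoots (Nat.pos_of_ne_zero hn)]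
  rw [h, ncard_coe_finset, Multiset.toFinset_card_of_nodup (hζ.nthRoots_nodup ha),
    hζ.card_nthRoots, if_pos ⟨_, Complex.cpow_nat_inv_pow a hn⟩]

theorem hasDegree_belyiMap (g : ℕ) : HasDegree (belyiMap g) (2 * g + 1) := by
  intro c
  induction c using OnePoint.rec with
  | infty =>
    rw [belyiMap_preimage_infty, finsum_mem_singleton]
    exact ⟨finite_singleton _, ramificationIndex_infty g⟩
  | coe c =>
    by_cases hc : (2 * c - 1) ^ 2 = 1
    · let q : AffineCurve g := ⟨(0, 2 * c - 1), by simpa using hc⟩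
      rw [belyiMap_preimage_of_x_eq_zero (q := q) rfl rfl, finsum_mem_singleton]
      exact ⟨finite_singleton _, ramificationIndex_of_x_eq_zero rfl⟩
    · have ha : (2 * c - 1) ^ 2 - 1 ≠ 0 := sub_ne_zero.2 hc
      have hinj : InjOn xCoord (belyiMap g ⁻¹' {(c : OnePoint ℂ)}) := by
        rw [belyiMap_preimage_coe]
        rintro _ ⟨q, hq, rfl⟩ _ ⟨r, hr, rfl⟩ h
        exact congrArg _ (Subtype.ext (Prod.ext h (Eq.trans hq (Eq.symm hr))))
      have himg : xCoord '' (belyiMap g ⁻¹' {(c : OnePoint ℂ)}) =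
          {x : ℂ | x ^ (2 * g + 1) = (2 * c - 1) ^ 2 - 1} := by
        rw [belyiMap_preimage_coe, image_image]
        ext x
        constructor
        · rintro ⟨q, hq, rfl⟩
          have hq' : q.1.2 = 2 * c - 1 := hq
          exact (x_pow_eq q).trans (by rw [hq'])
        · intro hx
          have hx' : x ^ (2 * g + 1) = (2 * c - 1) ^ 2 - 1 := hx
          exact ⟨⟨(x, 2 * c - 1), by simp only [hx']; ring⟩, rfl, rfl⟩
      have hcard := ncard_pow_eq (Nat.succ_ne_zero (2 * g)) ha
      rw [Nat.succ_eq_add_one, ← himg, hinj.ncard_image] at hcard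
      refine ⟨finite_of_ncard_ne_zero (by omega), ?_⟩
      rw [finsum_mem_congr rfl (g := fun _ => 1), finsum_one, hcard]
      intro p hp
      rw [belyiMap_preimage_coe] at hp
      obtain ⟨q, hq, rfl⟩ := hp
      have hq' : q.1.2 = 2 * c - 1 := hq
      refine ramificationIndex_of_x_ne_zero fun hx => ha ?_
      rw [← hq', ← x_pow_eq, hx, zero_pow (Nat.succ_ne_zero _)]

theorem surjective_belyiMap (g : ℕ) : Function.Surjective (belyiMap g) := by
  intro c
  by_contra! h
  have h1 : belyiMap g ⁻¹' {c} = ∅ := by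
    ext p
    simpa using h p
  have h2 := (hasDegree_belyiMap g c).2
  rw [h1, finsum_mem_empty] at h2
  omega

theorem ramificationOver_of_preimage_eq_singleton {X : Type*} [TopologicalSpace X]
    [ChartedSpace ℂ X] {β : X → OnePoint ℂ} {c : OnePoint ℂ} {p : X} (h : β ⁻¹' {c} = {p}) :
    ramificationOver β c = {ramificationIndex β p} := by
  have hf : (β ⁻¹' {c}).Finite := h ▸ finite_singleton p
  have h1 : hf.toFinset = {p} := by
    ext r
    rw [Set.Finite.mem_toFinset, h, mem_singleton_iff, Finset.mem_singleton]
  rw [ramificationOver, dif_pos hf, h1]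
  rfl

theorem isBelyiPair_belyiMap (g : ℕ) : IsBelyiPair (HyperellipticCurve g) (belyiMap g) where
  isManifold := isManifold_hyperellipticCurve g
  t2Space := t2Space_hyperellipticCurve g
  compactSpace := inferInstance
  connectedSpace := connectedSpace_hyperellipticCurve g
  holomorphic := mdifferentiable_belyiMap g
  surjective := surjective_belyiMap g
  unramified p h0 h1 hinf := by
    induction p using OnePoint.rec with
    | infty => exact absurd rfl hinf
    | coe q =>
      refine ramificationIndex_of_x_ne_zero fun hx => ?_
      have hy : q.1.2 ^ 2 = 1 := by rw [q.2, hx, zero_pow (Nat.succ_ne_zero _), zero_add]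
      rcases sq_eq_one_iff.1 hy with h | h
      · exact h1 (by rw [belyiMap_coe, h]; norm_num)
      · exact h0 (by rw [belyiMap_coe, h]; norm_num)

end BelyiMap

/-! ### Entire functions of polynomial growth -/

section PolynomialGrowth

/-- Liouville's theorem for functions of polynomial growth, by Cauchy's estimates. -/
theorem Differentiable.exists_polynomial_of_norm_le {f : ℂ → ℂ} (hf : Differentiable ℂ f) {k : ℕ}
    {C R₀ : ℝ} (hC : 0 ≤ C) (hb : ∀ z, R₀ ≤ ‖z‖ → ‖f z‖ ≤ C * ‖z‖ ^ k) :
    ∃ P : Polynomial ℂ, P.natDegree ≤ k ∧ ∀ z, f z = P.eval z := by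
  have hz : ∀ n, k < n → iteratedDeriv n f 0 = 0 := by
    intro n hn
    have h1 : ∀ᶠ R : ℝ in atTop, ‖iteratedDeriv n f 0‖ ≤ n.factorial * C * R⁻¹ := by
      filter_upwards [eventually_ge_atTop R₀, eventually_ge_atTop 1] with R hR hR1
      have hR0 : 0 < R := by linarith
      refine (Complex.norm_iteratedDeriv_le_of_forall_mem_sphere_norm_le (C := C * R ^ k) n hR0
        hf.diffContOnCl fun z hz => ?_).trans ?_
      · rw [mem_sphere_zero_iff_norm] at hz
        have := hb z (by rw [hz]; exact hR)
        rwa [hz] at this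
      · rw [← mul_assoc, mul_div_assoc]
        refine mul_le_mul_of_nonneg_left ?_ (by positivity)
        rw [div_le_iff₀ (by positivity), inv_mul_eq_div, le_div_iff₀ hR0, ← pow_succ]
        exact pow_le_pow_right₀ hR1 hn
    have h2 : Tendsto (fun R : ℝ => n.factorial * C * R⁻¹) atTop (𝓝 0) := by
      simpa using tendsto_inv_atTop_zero.const_mul (n.factorial * C)
    exact norm_le_zero_iff.1 (ge_of_tendsto h2 h1)
  refine ⟨∑ n ∈ Finset.range (k + 1),
    Polynomial.monomial n ((n.factorial : ℂ)⁻¹ * iteratedDeriv n f 0), ?_, fun z => ?_⟩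
  · refine Polynomial.natDegree_sum_le_of_forall_le _ _ fun n hn => ?_
    exact (Polynomial.natDegree_monomial_le _).trans (Nat.lt_succ_iff.1 (Finset.mem_range.1 hn))
  · rw [← Complex.taylorSeries_eq_of_entire' 0 z hf, Polynomial.eval_finsetSum,
      tsum_eq_sum (s := Finset.range (k + 1))]
    · simp
    · intro n hn
      rw [hz n (by simpa using hn), mul_zero, zero_mul]

end PolynomialGrowth

/-! ### The trace to the `x`-line -/

section Trace

variable {g : ℕ}

/-- The sum of the values of `F` at the two points `(x, ±y)` over `x` (at a branch point, twice the
value of `F`). -/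
noncomputable def trace (F : AffineCurve g → ℂ) (x : ℂ) : ℂ :=
  F (sqrtPoint g x) + F (involution (sqrtPoint g x))

theorem trace_eq (F : AffineCurve g → ℂ) (q : AffineCurve g) :
    trace F q.1.1 = F q + F (involution q) := by
  rcases eq_or_eq_involution (q := q) (r := sqrtPoint g q.1.1) rfl with h | h
  · rw [trace, ← h]
  · have h' : involution q = sqrtPoint g q.1.1 := by rw [h, involution_involution, ← h]
    rw [trace, ← h, h', add_comm]

theorem continuousAt_sqrtPoint {x : ℂ} (hx : x ^ (2 * g + 1) + 1 = 0) :
    ContinuousAt (sqrtPoint g) x := by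
  refine Topology.IsInducing.subtypeVal.continuousAt_iff.2 (continuousAt_id.prodMk ?_)
  refine ContinuousAt.comp (g := fun w : ℂ => w ^ (((2 : ℕ) : ℂ)⁻¹))
    (f := fun x : ℂ => x ^ (2 * g + 1) + 1) ?_ (by fun_prop)
  rw [hx]
  exact Complex.continuousAt_cpow_const_of_re_pos (Or.inl le_rfl) (by norm_num)

/-- The trace of a holomorphic function is entire: away from the branch points this is seen in the
charts `x`, and the branch points are removable singularities. -/
theorem differentiable_trace {F : AffineCurve g → ℂ}
    (hF : ∀ p (hp : p.1.2 ≠ 0), DifferentiableAt ℂ (fun z => F ((xChart p hp).symm z)) p.1.1)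
    (hF0 : ∀ p : AffineCurve g, p.1.2 = 0 → ContinuousAt F p) : Differentiable ℂ (trace F) := by
  have hd : ∀ p : AffineCurve g, p.1.2 ≠ 0 → DifferentiableAt ℂ (trace F) p.1.1 := by
    intro p hp
    have hp' : (involution p).1.2 ≠ 0 := neg_ne_zero.2 hp
    have h : trace F = fun z =>
        F ((xChart p hp).symm z) + F ((xChart (involution p) hp').symm z) := by
      ext z
      refine (trace_eq F ((xChart p hp).symm z)).trans (congrArg (fun r =>
        F ((xChart p hp).symm z) + F r) ?_)
      refine Subtype.ext (Prod.ext rfl ?_)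
      change -(p.1.2 * ((z ^ (2 * g + 1) + 1) / p.1.2 ^ 2) ^ (((2 : ℕ) : ℂ)⁻¹)) =
        -p.1.2 * ((z ^ (2 * g + 1) + 1) / (-p.1.2) ^ 2) ^ (((2 : ℕ) : ℂ)⁻¹)
      rw [neg_sq, neg_mul]
    rw [h]
    exact (hF p hp).add (hF (involution p) hp')
  intro x
  by_cases hy : (sqrtPoint g x).1.2 = 0
  · have hx : x ^ (2 * g + 1) + 1 = 0 := by
      have := (sqrtPoint g x).2
      rw [hy] at this
      simpa using this.symm
    have hx0 : x ≠ 0 := x_ne_zero_of_y_eq_zero hy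
    refine (Complex.analyticAt_of_differentiable_on_punctured_nhds_of_continuousAt ?_
      ?_).differentiableAt
    · have h1 : HasDerivAt (fun x : ℂ => x ^ (2 * g + 1) + 1)
          (((2 * g + 1 : ℕ) : ℂ) * x ^ (2 * g)) x :=
        (hasDerivAt_pow (2 * g + 1) x).add_const 1
      filter_upwards [h1.eventually_ne (c := 0) (mul_ne_zero
        (by exact_mod_cast Nat.succ_ne_zero (2 * g)) (pow_ne_zero _ hx0))] with z hz
      refine hd (sqrtPoint g z) fun h => hz ?_
      have := (sqrtPoint g z).2
      rw [h] at this
      simpa using this.symm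
    · have h1 := continuousAt_sqrtPoint hx
      have hy' : (involution (sqrtPoint g x)).1.2 = 0 := neg_eq_zero.2 hy
      exact ((hF0 _ hy).comp h1).add
        (ContinuousAt.comp (hF0 _ hy') (continuous_involution.continuousAt.comp h1))
  · exact hd (sqrtPoint g x) hy

end Trace

/-! ### Holomorphic forms as functions on the affine curve -/

section Forms

variable {g : ℕ}

/-- The function `η / (dx/y)` on the affine curve. In the preferred charts it is `η y`
where `y ≠ 0`, and `η (2g+1) x^(2g) / 2` where `y = 0`, since `dx/y = 2 dy / ((2g+1) x^(2g))`. -/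
noncomputable def formRatio (g : ℕ) : holomorphicOneForms (HyperellipticCurve g) →ₗ[ℂ]
    (AffineCurve g → ℂ) where
  toFun η q := η.1 ⟨chartAt ℂ (q : HyperellipticCurve g), chart_mem_atlas ℂ _⟩
      (chartAt ℂ (q : HyperellipticCurve g) q) *
    (if q.1.2 = 0 then (2 * g + 1) * q.1.1 ^ (2 * g) / 2 else q.1.2)
  map_add' η₁ η₂ := by
    ext q
    exact add_mul _ _ _
  map_smul' c η := by
    ext q
    exact mul_assoc _ _ _

theorem deriv_transition_xChartExt {e : OpenPartialHomeomorph (HyperellipticCurve g) ℂ} {z : ℂ}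
    (hz : z ∈ e.target) (h : e.symm z ≠ OnePoint.infty) (p : AffineCurve g) (hp : p.1.2 ≠ 0) :
    deriv (fun w => xChartExt p hp (e.symm w)) z = deriv (fun w => xCoord (e.symm w)) z := by
  refine EventuallyEq.deriv_eq ?_
  filter_upwards [eventually_symm_ne_infty hz h] with w hw
  obtain ⟨-, r, hr⟩ := hw
  rw [hr, xChartExt_coe, xCoord_coe]

theorem deriv_transition_yChartExt {e : OpenPartialHomeomorph (HyperellipticCurve g) ℂ} {z : ℂ}
    (hz : z ∈ e.target) (h : e.symm z ≠ OnePoint.infty) (p : AffineCurve g) (hp : p.1.1 ≠ 0) :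
    deriv (fun w => yChartExt p hp (e.symm w)) z = deriv (fun w => yCoord (e.symm w)) z := by
  refine EventuallyEq.deriv_eq ?_
  filter_upwards [eventually_symm_ne_infty hz h] with w hw
  obtain ⟨-, r, hr⟩ := hw
  rw [hr, yChartExt_coe, yCoord_coe]

theorem deriv_xCoord_xChartExt_symm (p : AffineCurve g) (hp : p.1.2 ≠ 0) (z : ℂ) :
    deriv (fun w => xCoord ((xChartExt p hp).symm w)) z = 1 :=
  deriv_id z

theorem deriv_yCoord_yChartExt_symm (p : AffineCurve g) (hp : p.1.1 ≠ 0) (z : ℂ) :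
    deriv (fun w => yCoord ((yChartExt p hp).symm w)) z = 1 :=
  deriv_id z

theorem deriv_xCoord_inftyChart_symm {z : ℂ} (hz : z ≠ 0) :
    deriv (fun w => xCoord ((inftyChart g).symm w)) z = -2 / z ^ 3 := by
  simp only [xCoord_inftyChart_symm]
  have h := ((hasDerivAt_pow 2 z).fun_inv (pow_ne_zero _ hz)).deriv
  rw [h]
  push_cast
  field_simp

/-- `η = F dx/y` in every chart, where `F = formRatio g η` and `y ≠ 0`. -/
theorem form_eq_of_y_ne_zero (η : holomorphicOneForms (HyperellipticCurve g))
    (e : atlas ℂ (HyperellipticCurve g)) {z : ℂ} (hz : z ∈ e.1.target) {q : AffineCurve g}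
    (hq : e.1.symm z = q) (hy : q.1.2 ≠ 0) :
    η.1 e z = formRatio g η q / q.1.2 * deriv (fun w => xCoord (e.1.symm w)) z := by
  have h : e.1.symm z ≠ OnePoint.infty := by simp [hq]
  have hs : z ∈ (e.1.symm.trans (chartAt ℂ (q : HyperellipticCurve g))).source :=
    ⟨hz, (congrArg (· ∈ (chartAt ℂ (q : HyperellipticCurve g)).source) hq).mpr
      (mem_chart_source ℂ _)⟩
  have hc := η.2.2.2 e ⟨chartAt ℂ (q : HyperellipticCurve g), chart_mem_atlas ℂ _⟩ z hs
  have hd := deriv_transition_xChartExt hz h q hy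
  rw [← chartAt_of_y_ne_zero hy] at hd
  rw [hc, hd, hq]
  congr 1
  rw [eq_div_iff hy]
  simp [formRatio, hy]

/-- `dx/y = 2 dy / ((2g+1) x^(2g))` in a chart `y`. -/
theorem formRatio_eq_of_yChartExt (η : holomorphicOneForms (HyperellipticCurve g))
    {p : AffineCurve g} {hp : p.1.1 ≠ 0} (he : yChartExt p hp ∈ atlas ℂ (HyperellipticCurve g))
    {z : ℂ} (hz : z ∈ (yChartExt p hp).target) {q : AffineCurve g}
    (hq : (yChartExt p hp).symm z = q) :
    formRatio g η q = η.1 ⟨yChartExt p hp, he⟩ z * ((2 * g + 1) * q.1.1 ^ (2 * g) / 2) := by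
  have h : (yChartExt p hp).symm z ≠ OnePoint.infty := by simp [hq]
  by_cases hy : q.1.2 = 0
  · have hs : z ∈ ((yChartExt p hp).symm.trans (chartAt ℂ (q : HyperellipticCurve g))).source :=
      ⟨hz, (congrArg (· ∈ (chartAt ℂ (q : HyperellipticCurve g)).source) hq).mpr
      (mem_chart_source ℂ _)⟩
    have hc := η.2.2.2 ⟨yChartExt p hp, he⟩
      ⟨chartAt ℂ (q : HyperellipticCurve g), chart_mem_atlas ℂ _⟩ z hs
    have hd := deriv_transition_yChartExt hz h q (x_ne_zero_of_y_eq_zero hy)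
    rw [← chartAt_of_y_eq_zero hy] at hd
    rw [hc, hd, hq, deriv_yCoord_yChartExt_symm]
    simp [formRatio, hy]
  · have h1 := two_mul_y_mul_deriv_y he hz hq
    rw [deriv_yCoord_yChartExt_symm] at h1
    rw [form_eq_of_y_ne_zero η ⟨yChartExt p hp, he⟩ hz hq hy]
    field_simp
    linear_combination formRatio g η q * h1

theorem y_ne_zero_of_xChartExt_symm {p : AffineCurve g} {hp : p.1.2 ≠ 0} {z : ℂ}
    (hz : z ∈ (xChartExt p hp).target) {q : AffineCurve g} (hq : (xChartExt p hp).symm z = q) :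
    q.1.2 ≠ 0 :=
  y_ne_zero_of_mem_xChartExt_source (hq ▸ (xChartExt p hp).map_target hz)

theorem y_ne_zero_of_inftyChart_symm {z : ℂ}
    (hz : z ∈ (inftyChart g).target) {q : AffineCurve g} (hq : (inftyChart g).symm z = q) :
    q.1.2 ≠ 0 :=
  y_ne_zero (coe_mem_inftyChart_source.1 (hq ▸ (inftyChart g).map_target hz))

theorem inftyChart_mem_atlas (g : ℕ) : inftyChart g ∈ atlas ℂ (HyperellipticCurve g) :=
  chart_mem_atlas ℂ (OnePoint.infty : HyperellipticCurve g)

/-- A form is determined by its ratio to `dx/y`, by continuity also at `∞`. -/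
theorem injective_formRatio (g : ℕ) : Function.Injective (formRatio g) := by
  rw [← LinearMap.ker_eq_bot, LinearMap.ker_eq_bot']
  intro η hη
  have haff : ∀ (e : atlas ℂ (HyperellipticCurve g)) (z : ℂ), z ∈ e.1.target →
      e.1.symm z ≠ OnePoint.infty → η.1 e z = 0 := by
    intro e z hz h
    obtain ⟨q, hq⟩ := (eventually_symm_ne_infty hz h).self_of_nhds.2
    by_cases hy : q.1.2 = 0
    · obtain ⟨e, he⟩ := e
      rcases atlas_cases he with ⟨p, hp, rfl⟩ | ⟨p, hp, rfl⟩ | rfl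
      · exact absurd hy (y_ne_zero_of_xChartExt_symm hz hq)
      · have h1 := formRatio_eq_of_yChartExt η he hz hq
        rw [hη, Pi.zero_apply, eq_comm] at h1
        refine (mul_eq_zero.1 h1).resolve_right (div_ne_zero (mul_ne_zero ?_ (pow_ne_zero _
          (x_ne_zero_of_y_eq_zero hy))) two_ne_zero)
        exact_mod_cast Nat.succ_ne_zero (2 * g)
      · exact absurd hy (y_ne_zero_of_inftyChart_symm hz hq)
    · rw [form_eq_of_y_ne_zero η e hz hq hy, hη]
      simp
  refine Subtype.ext (funext fun e => funext fun z => ?_)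
  by_cases hz : z ∈ e.1.target
  · by_cases h : e.1.symm z = OnePoint.infty
    · obtain ⟨e, he⟩ := e
      obtain rfl := eq_inftyChart_of_infty_mem he (h ▸ e.map_target hz)
      have hz0 : z = 0 := by
        rw [← (inftyChart g).right_inv hz]
        exact (congrArg _ h).trans inftyChart_infty
      subst hz0
      have hc : ContinuousAt (η.1 ⟨inftyChart g, he⟩) 0 :=
        (η.2.1 ⟨inftyChart g, he⟩).continuousOn.continuousAt
          ((inftyChart g).open_target.mem_nhds hz)
      refine tendsto_nhds_unique (hc.tendsto.mono_left nhdsWithin_le_nhds)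
        (tendsto_const_nhds.congr' (f₁ := fun _ => 0) (l₁ := 𝓝[≠] (0 : ℂ)) ?_)
      filter_upwards [mem_nhdsWithin_of_mem_nhds ((inftyChart g).open_target.mem_nhds hz),
        self_mem_nhdsWithin] with w hw hw0
      refine (haff ⟨inftyChart g, he⟩ w hw ?_).symm
      rw [inftyChart_symm_of_ne hw0]
      exact OnePoint.coe_ne_infty _
    · exact haff e z hz h
  · exact η.2.2.1 e z hz

theorem formRatio_xChart_symm (η : holomorphicOneForms (HyperellipticCurve g))
    {p : AffineCurve g} {hp : p.1.2 ≠ 0} (he : xChartExt p hp ∈ atlas ℂ (HyperellipticCurve g))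
    {z : ℂ} (hz : z ∈ (xChartExt p hp).target) :
    formRatio g η ((xChart p hp).symm z) =
      η.1 ⟨xChartExt p hp, he⟩ z * ((xChart p hp).symm z).1.2 := by
  have hy := y_ne_zero_of_xChartExt_symm hz (q := (xChart p hp).symm z) rfl
  rw [form_eq_of_y_ne_zero η ⟨xChartExt p hp, he⟩ hz (q := (xChart p hp).symm z) rfl hy,
    deriv_xCoord_xChartExt_symm]
  field_simp

theorem xChartExt_mem_atlas {p : AffineCurve g} (hp : p.1.2 ≠ 0) :
    xChartExt p hp ∈ atlas ℂ (HyperellipticCurve g) :=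
  chartAt_of_y_ne_zero hp ▸ chart_mem_atlas ℂ _

theorem differentiableAt_formRatio (η : holomorphicOneForms (HyperellipticCurve g))
    (p : AffineCurve g) (hp : p.1.2 ≠ 0) :
    DifferentiableAt ℂ (fun z => formRatio g η ((xChart p hp).symm z)) p.1.1 := by
  have he := xChartExt_mem_atlas hp
  have hz : p.1.1 ∈ (xChartExt p hp).target := by
    have := mem_chart_target ℂ (p : HyperellipticCurve g)
    rwa [chartAt_of_y_ne_zero hp, xChartExt_coe] at this
  have hn := (xChartExt p hp).open_target.mem_nhds hz
  have h1 : DifferentiableAt ℂ (η.1 ⟨xChartExt p hp, he⟩) p.1.1 :=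
    (η.2.1 ⟨xChartExt p hp, he⟩).differentiableAt hn
  have h2 : DifferentiableAt ℂ (fun z => ((xChart p hp).symm z).1.2) p.1.1 :=
    differentiableAt_yCoord_symm he hz (OnePoint.coe_ne_infty ((xChart p hp).symm p.1.1))
  refine (h1.mul h2).congr_of_eventuallyEq ?_
  filter_upwards [hn] with z hz
  exact formRatio_xChart_symm η he hz

theorem continuousAt_formRatio (η : holomorphicOneForms (HyperellipticCurve g))
    (p : AffineCurve g) (hy : p.1.2 = 0) : ContinuousAt (formRatio g η) p := by
  have hp := x_ne_zero_of_y_eq_zero hy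
  have he : yChartExt p hp ∈ atlas ℂ (HyperellipticCurve g) :=
    chartAt_of_y_eq_zero hy ▸ chart_mem_atlas ℂ _
  have hps : p ∈ (yChart p hp).source := by
    refine (coe_mem_yChartExt_source (hp := hp)).1 ?_
    rw [← chartAt_of_y_eq_zero hy]
    exact mem_chart_source ℂ _
  have h1 : ContinuousAt (η.1 ⟨yChartExt p hp, he⟩) (yChart p hp p) :=
    (η.2.1 ⟨yChartExt p hp, he⟩).continuousOn.continuousAt
      ((yChartExt p hp).open_target.mem_nhds ((yChart p hp).map_source hps))
  have h2 : ContinuousAt (fun q => η.1 ⟨yChartExt p hp, he⟩ (yChart p hp q) *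
      ((2 * g + 1) * q.1.1 ^ (2 * g) / 2)) p :=
    (ContinuousAt.comp h1 ((yChart p hp).continuousAt hps)).mul (by fun_prop)
  refine h2.congr ?_
  filter_upwards [(yChart p hp).open_source.mem_nhds hps] with q hq
  refine (formRatio_eq_of_yChartExt η he ((yChart p hp).map_source hq) ?_).symm
  exact congrArg OnePoint.some ((yChart p hp).left_inv hq)

theorem norm_y_sq_le {q : AffineCurve g} (hx : 1 ≤ ‖q.1.1‖) :
    ‖q.1.2‖ ^ 2 ≤ 2 * ‖q.1.1‖ ^ (2 * g + 1) := by
  rw [← norm_pow, q.2]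
  refine (norm_add_le _ _).trans ?_
  rw [norm_pow, norm_one]
  linarith [one_le_pow₀ hx (n := 2 * g + 1)]

/-- Near `∞`, where `η = h dε`, the ratio of `η` to `dx/y` is `-h y ε³ / 2 = O(x^(g-1))`. -/
theorem exists_norm_formRatio_le (hg : 1 ≤ g) (η : holomorphicOneForms (HyperellipticCurve g)) :
    ∃ C, 0 ≤ C ∧ ∀ q : AffineCurve g, 2 ≤ ‖q.1.1‖ →
      ‖formRatio g η q‖ ≤ C * ‖q.1.1‖ ^ (g - 1) := by
  -- `|x| ≥ 2` means `|ε|² ≤ 1/2`, and `1/2 < (3/4)²`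
  have hsub : Metric.closedBall (0 : ℂ) (3 / 4) ⊆ (inftyChart g).target :=
    Metric.closedBall_subset_ball (by norm_num)
  obtain ⟨C, hC⟩ := (isCompact_closedBall (0 : ℂ) (3 / 4)).exists_bound_of_continuousOn
    ((η.2.1 ⟨inftyChart g, inftyChart_mem_atlas g⟩).continuousOn.mono hsub)
  have hC0 : 0 ≤ C := (norm_nonneg _).trans (hC 0 (Metric.mem_closedBall_self (by norm_num)))
  refine ⟨C, hC0, fun q hq => ?_⟩
  have hq1 : 1 < ‖q.1.1‖ := by linarith
  have hx0 : 0 < ‖q.1.1‖ := by linarith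
  have hz2 : ‖inftyCoord q‖ ^ 2 = ‖q.1.1‖⁻¹ := by
    rw [← norm_pow, inftyCoord_sq hq1, norm_inv]
  have hle : ‖q.1.1‖⁻¹ ≤ 2⁻¹ := inv_anti₀ two_pos hq
  have hz0 : inftyCoord q ≠ 0 := by
    intro h
    rw [h, norm_zero, zero_pow two_ne_zero] at hz2
    exact (inv_pos.2 hx0).ne hz2
  have hzb : inftyCoord q ∈ Metric.closedBall (0 : ℂ) (3 / 4) := by
    rw [mem_closedBall_zero_iff]
    refine abs_le_of_sq_le_sq' ?_ (by norm_num) |>.2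
    rw [hz2]
    norm_num at hle ⊢
    linarith
  have hqs : (q : HyperellipticCurve g) ∈ (inftyChart g).source :=
    coe_mem_inftyChart_source.2 hq1
  have hs : (inftyChart g).symm (inftyCoord q) = q := (inftyChart g).left_inv hqs
  have hy := y_ne_zero hq1
  have h1 := form_eq_of_y_ne_zero η ⟨inftyChart g, inftyChart_mem_atlas g⟩ (hsub hzb) hs hy
  rw [deriv_xCoord_inftyChart_symm hz0] at h1
  have h2 : 2 * formRatio g η q = -(η.1 ⟨inftyChart g, inftyChart_mem_atlas g⟩ (inftyCoord q) *
      q.1.2 * inftyCoord q ^ 3) := by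
    rw [h1]
    field_simp
  have h3 := congrArg norm h2
  rw [norm_neg, norm_mul, norm_mul, norm_mul, norm_pow, Complex.norm_ofNat] at h3
  have h4 := hC _ hzb
  have h5 := norm_y_sq_le hq1.le
  have h6 : (2 * ‖formRatio g η q‖) ^ 2 ≤ 2 * (C * ‖q.1.1‖ ^ (g - 1)) ^ 2 := by
    obtain ⟨k, rfl⟩ := Nat.exists_eq_add_of_le' hg
    calc (2 * ‖formRatio (k + 1) η q‖) ^ 2
        = ‖η.1 ⟨inftyChart (k + 1), inftyChart_mem_atlas (k + 1)⟩ (inftyCoord q)‖ ^ 2 *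
          ‖q.1.2‖ ^ 2 * (‖inftyCoord q‖ ^ 2) ^ 3 := by
            rw [h3]
            ring
      _ ≤ C ^ 2 * (2 * ‖q.1.1‖ ^ (2 * (k + 1) + 1)) * (‖inftyCoord q‖ ^ 2) ^ 3 := by gcongr
      _ = 2 * (C * ‖q.1.1‖ ^ (k + 1 - 1)) ^ 2 := by
            rw [hz2, Nat.add_sub_cancel]
            field_simp
            ring
  have h7 : 0 ≤ C * ‖q.1.1‖ ^ (g - 1) := by positivity
  nlinarith [norm_nonneg (formRatio g η q)]

theorem norm_trace_le {F : AffineCurve g → ℂ} {C : ℝ} {k : ℕ}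
    (hF : ∀ q : AffineCurve g, 2 ≤ ‖q.1.1‖ → ‖F q‖ ≤ C * ‖q.1.1‖ ^ k) (x : ℂ) (hx : 2 ≤ ‖x‖) :
    ‖trace F x‖ ≤ 2 * C * ‖x‖ ^ k := by
  have h1 := hF (sqrtPoint g x) hx
  have h2 := hF (involution (sqrtPoint g x)) hx
  rw [involution_x, sqrtPoint_x] at h2
  rw [sqrtPoint_x] at h1
  refine (norm_add_le _ _).trans ?_
  linarith

/-- The anti-invariant part of the ratio to `dx/y` vanishes: the trace of `y` times the ratio is a
polynomial of degree at most `2g` in `x` which vanishes at all `2g+1` branch points. -/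
theorem trace_y_mul_formRatio (hg : 1 ≤ g) (η : holomorphicOneForms (HyperellipticCurve g)) :
    trace (fun q => q.1.2 * formRatio g η q) = 0 := by
  obtain ⟨C, hC, hb⟩ := exists_norm_formRatio_le hg η
  have hdiff : Differentiable ℂ (trace fun q => q.1.2 * formRatio g η q) := by
    refine differentiable_trace (fun p hp => ?_) fun p hy =>
      ContinuousAt.mul (by fun_prop) (continuousAt_formRatio η p hy)
    have hz : p.1.1 ∈ (xChartExt p hp).target := by
      have := mem_chart_target ℂ (p : HyperellipticCurve g)
      rwa [chartAt_of_y_ne_zero hp, xChartExt_coe] at this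
    exact DifferentiableAt.mul (differentiableAt_yCoord_symm (xChartExt_mem_atlas hp) hz
      (OnePoint.coe_ne_infty ((xChart p hp).symm p.1.1))) (differentiableAt_formRatio η p hp)
  have hb' : ∀ q : AffineCurve g, 2 ≤ ‖q.1.1‖ →
      ‖q.1.2 * formRatio g η q‖ ≤ 2 * C * ‖q.1.1‖ ^ (2 * g) := by
    intro q hq
    have hq1 : 1 ≤ ‖q.1.1‖ := by linarith
    have h1 := norm_y_sq_le hq1
    have h2 := hb q hq
    refine abs_le_of_sq_le_sq' ?_ (by positivity) |>.2
    obtain ⟨k, rfl⟩ := Nat.exists_eq_add_of_le' hg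
    rw [Nat.add_sub_cancel] at h2
    calc ‖q.1.2 * formRatio (k + 1) η q‖ ^ 2
        = ‖q.1.2‖ ^ 2 * ‖formRatio (k + 1) η q‖ ^ 2 := by rw [norm_mul, mul_pow]
      _ ≤ (2 * ‖q.1.1‖ ^ (2 * (k + 1) + 1)) * (C * ‖q.1.1‖ ^ k) ^ 2 := by gcongr
      _ = 2 * C ^ 2 * ‖q.1.1‖ ^ (4 * k + 3) := by ring
      _ ≤ 4 * C ^ 2 * ‖q.1.1‖ ^ (4 * k + 4) := by
          gcongr
          · norm_num
          · norm_num
      _ = (2 * C * ‖q.1.1‖ ^ (2 * (k + 1))) ^ 2 := by ring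
  obtain ⟨P, hP, hPe⟩ := hdiff.exists_polynomial_of_norm_le (by positivity) (norm_trace_le hb')
  have hroots : ∀ x ∈ {x : ℂ | x ^ (2 * g + 1) = -1}, P.eval x = 0 := by
    intro x hx
    have hx' : x ^ (2 * g + 1) = -1 := hx
    rw [← hPe, show x = (⟨(x, 0), by simp [hx']⟩ : AffineCurve g).1.1 from rfl, trace_eq]
    simp
  have hcard := ncard_pow_eq (Nat.succ_ne_zero (2 * g)) (neg_ne_zero.2 (one_ne_zero (α := ℂ)))
  rw [Nat.succ_eq_add_one] at hcard
  have hfin : {x : ℂ | x ^ (2 * g + 1) = -1}.Finite := finite_of_ncard_ne_zero (by omega)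
  have hP0 : P = 0 := by
    refine Polynomial.eq_zero_of_natDegree_lt_card_of_eval_eq_zero' P hfin.toFinset
      (fun x hx => hroots x (hfin.mem_toFinset.1 hx)) ?_
    rw [← ncard_eq_toFinset_card _ hfin]
    omega
  ext x
  rw [hPe, hP0, Polynomial.eval_zero, Pi.zero_apply]

/-- Every holomorphic form is `P(x) dx/y` with a polynomial `P` of degree less than `g`. -/
theorem exists_polynomial_formRatio (hg : 1 ≤ g)
    (η : holomorphicOneForms (HyperellipticCurve g)) :
    ∃ P ∈ Polynomial.degreeLT ℂ g, ∀ q : AffineCurve g, formRatio g η q = P.eval q.1.1 := by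
  obtain ⟨C, hC, hb⟩ := exists_norm_formRatio_le hg η
  have hdiff : Differentiable ℂ (trace (formRatio g η)) :=
    differentiable_trace (differentiableAt_formRatio η) (continuousAt_formRatio η)
  obtain ⟨P, hP, hPe⟩ := hdiff.exists_polynomial_of_norm_le (by positivity) (norm_trace_le hb)
  have hPg : P ∈ Polynomial.degreeLT ℂ g := by
    rw [Polynomial.mem_degreeLT]
    refine Polynomial.degree_le_natDegree.trans_lt ?_
    exact_mod_cast (by omega : P.natDegree < g)
  refine ⟨(2 : ℂ)⁻¹ • P, Submodule.smul_mem _ _ hPg, fun q => ?_⟩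
  have h1 := hPe q.1.1
  rw [trace_eq] at h1
  have h2 : formRatio g η (involution q) = formRatio g η q := by
    by_cases hy : q.1.2 = 0
    · rw [show involution q = q from Subtype.ext (Prod.ext rfl (by simp [hy]))]
    · have h3 := congrFun (trace_y_mul_formRatio hg η) q.1.1
      rw [trace_eq, involution_y, Pi.zero_apply] at h3
      refine mul_left_cancel₀ hy ?_
      linear_combination -h3
  rw [h2] at h1
  rw [Polynomial.eval_smul, ← h1, smul_eq_mul]
  ring

end Forms

/-! ### The forms `x^k dx/y` and the genus -/

section Genus

variable {g : ℕ}

open Classical in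
/-- The coefficients of the form `x^k dx/y`, for `k < g`: at the branch points `y = 0`, which lie
only in charts `y`, it is `2 x^k dy / ((2g+1) x^(2g))`, and at `∞` it is
`-2 ε^(2(g-1-k)) dε / √(1 + ε^(2(2g+1)))`, evaluated at `ε = 0`. -/
noncomputable def monomialForm (g k : ℕ) (e : atlas ℂ (HyperellipticCurve g)) (z : ℂ) : ℂ :=
  if z ∈ e.1.target then
    (e.1.symm z).elim (-2 * 0 ^ (2 * (g - 1 - k))) (fun q =>
      if q.1.2 = 0 then 2 * q.1.1 ^ k / ((2 * g + 1) * q.1.1 ^ (2 * g))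
      else q.1.1 ^ k / q.1.2 * deriv (fun w => xCoord (e.1.symm w)) z)
  else 0

theorem monomialForm_of_y_ne_zero (k : ℕ) (e : atlas ℂ (HyperellipticCurve g)) {z : ℂ}
    (hz : z ∈ e.1.target) {q : AffineCurve g} (hq : e.1.symm z = q) (hy : q.1.2 ≠ 0) :
    monomialForm g k e z = q.1.1 ^ k / q.1.2 * deriv (fun w => xCoord (e.1.symm w)) z := by
  rw [monomialForm, if_pos hz, hq, OnePoint.elim_some, if_neg hy]

theorem monomialForm_yChartExt (k : ℕ) {p : AffineCurve g} {hp : p.1.1 ≠ 0}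
    (he : yChartExt p hp ∈ atlas ℂ (HyperellipticCurve g))
    {z : ℂ} (hz : z ∈ (yChartExt p hp).target) {q : AffineCurve g}
    (hq : (yChartExt p hp).symm z = q) :
    monomialForm g k ⟨yChartExt p hp, he⟩ z =
      2 * q.1.1 ^ k / ((2 * g + 1) * q.1.1 ^ (2 * g)) := by
  by_cases hy : q.1.2 = 0
  · rw [monomialForm, if_pos hz, hq, OnePoint.elim_some, if_pos hy]
  · have hx : q.1.1 ≠ 0 := x_ne_zero_of_mem_yChartExt_source (hq ▸ (yChartExt p hp).map_target hz)
    have h1 := two_mul_y_mul_deriv_y he hz hq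
    have h3 : (2 * (g : ℂ) + 1) ≠ 0 := by exact_mod_cast Nat.succ_ne_zero (2 * g)
    rw [deriv_yCoord_yChartExt_symm] at h1
    rw [monomialForm_of_y_ne_zero k ⟨yChartExt p hp, he⟩ hz hq hy]
    field_simp
    linear_combination -h1

theorem monomialForm_inftyChart {k : ℕ} (hk : k < g) {z : ℂ} (hz : z ∈ (inftyChart g).target) :
    monomialForm g k ⟨inftyChart g, inftyChart_mem_atlas g⟩ z =
      -2 * z ^ (2 * (g - 1 - k)) / (1 + z ^ (2 * (2 * g + 1))) ^ (((2 : ℕ) : ℂ)⁻¹) := by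
  by_cases h : z = 0
  · subst h
    rw [monomialForm, if_pos hz, inftyChart_symm_zero, OnePoint.elim_infty,
      sqrt_one_add_zero_pow (by omega), div_one]
  · have hq := inftyChart_symm_of_ne (g := g) h
    have hy := y_ne_zero_of_inftyChart_symm hz hq
    rw [monomialForm_of_y_ne_zero k _ hz hq hy, deriv_xCoord_inftyChart_symm h]
    simp only [inftyPoint] at hy ⊢
    generalize (1 + z ^ (2 * (2 * g + 1))) ^ (((2 : ℕ) : ℂ)⁻¹) = S at hy ⊢
    have hS : S ≠ 0 := fun h0 => hy (by rw [h0, zero_div])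
    obtain ⟨m, rfl⟩ := Nat.exists_eq_add_of_lt hk
    rw [show k + m + 1 - 1 - k = m by omega, inv_pow, ← pow_mul]
    field_simp
    ring

theorem differentiableOn_monomialForm {k : ℕ} (hk : k < g) (e : atlas ℂ (HyperellipticCurve g)) :
    DifferentiableOn ℂ (monomialForm g k e) e.1.target := by
  obtain ⟨e, he⟩ := e
  intro z hz
  have hn := e.open_target.mem_nhds hz
  refine DifferentiableAt.differentiableWithinAt ?_
  change z ∈ e.target at hz
  rcases atlas_cases he with ⟨p, hp, rfl⟩ | ⟨p, hp, rfl⟩ | rfl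
  · have h := OnePoint.coe_ne_infty ((xChart p hp).symm z)
    have hX : DifferentiableAt ℂ (fun w => ((xChart p hp).symm w).1.1) z :=
      differentiableAt_xCoord_symm he hz h
    have hY : DifferentiableAt ℂ (fun w => ((xChart p hp).symm w).1.2) z :=
      differentiableAt_yCoord_symm he hz h
    refine ((hX.pow k).div hY (y_ne_zero_of_xChartExt_symm hz rfl)).congr_of_eventuallyEq ?_
    filter_upwards [hn] with w hw
    rw [monomialForm_of_y_ne_zero k ⟨xChartExt p hp, he⟩ hw rfl
      (y_ne_zero_of_xChartExt_symm hw rfl), deriv_xCoord_xChartExt_symm, mul_one]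
    rfl
  · have h := OnePoint.coe_ne_infty ((yChart p hp).symm z)
    have hX : DifferentiableAt ℂ (fun w => ((yChart p hp).symm w).1.1) z :=
      differentiableAt_xCoord_symm he hz h
    have hx : ((yChart p hp).symm z).1.1 ≠ 0 :=
      x_ne_zero_of_mem_yChartExt_source (hp := hp) ((yChartExt p hp).map_target hz)
    have h3 : (2 * (g : ℂ) + 1) ≠ 0 := by exact_mod_cast Nat.succ_ne_zero (2 * g)
    refine (((hX.pow k).const_mul 2).div ((hX.pow (2 * g)).const_mul (2 * g + 1))
      (mul_ne_zero h3 (pow_ne_zero _ hx))).congr_of_eventuallyEq ?_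
    filter_upwards [hn] with w hw
    exact monomialForm_yChartExt k he hw rfl
  · have hz' : ‖z‖ < 1 := mem_ball_zero_iff.1 hz
    have hS : (1 + z ^ (2 * (2 * g + 1))) ^ (((2 : ℕ) : ℂ)⁻¹) ≠ 0 := by
      rw [Ne, Complex.cpow_eq_zero_iff]
      exact fun h => Complex.slitPlane_ne_zero
        (one_add_mem_slitPlane (norm_pow_lt (by omega) hz')) h.1
    have hd : DifferentiableAt ℂ (fun z : ℂ => -2 * z ^ (2 * (g - 1 - k))) z := by fun_prop
    refine (hd.div (differentiableAt_sqrt_one_add_pow (by omega) hz') hS).congr_of_eventuallyEq ?_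
    filter_upwards [hn] with w hw
    exact monomialForm_inftyChart hk hw

theorem monomialForm_transition (k : ℕ) (e e' : atlas ℂ (HyperellipticCurve g)) {z : ℂ}
    (hz : z ∈ (e.1.symm.trans e'.1).source) :
    monomialForm g k e z = monomialForm g k e' (e'.1 (e.1.symm z)) *
      deriv (fun w => e'.1 (e.1.symm w)) z := by
  have hze : z ∈ e.1.target := hz.1
  have hze' : e.1.symm z ∈ e'.1.source := hz.2
  have hzt : e'.1 (e.1.symm z) ∈ e'.1.target := e'.1.map_source hze'
  by_cases h : e.1.symm z = OnePoint.infty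
  · have h1 : e.1 = inftyChart g := eq_inftyChart_of_infty_mem e.2 (h ▸ e.1.map_target hze)
    have h2 : e'.1 = inftyChart g := eq_inftyChart_of_infty_mem e'.2 (h ▸ hze')
    obtain rfl : e' = e := Subtype.ext (h2.trans h1.symm)
    have h3 : deriv (fun w => e'.1 (e'.1.symm w)) z = 1 := by
      refine (EventuallyEq.deriv_eq ?_).trans (deriv_id z)
      filter_upwards [e'.1.open_target.mem_nhds hze] with w hw
      exact e'.1.right_inv hw
    rw [h3, e'.1.right_inv hze, mul_one]
  · obtain ⟨q, hq⟩ := (eventually_symm_ne_infty hze h).self_of_nhds.2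
    have hq' : e'.1.symm (e'.1 (e.1.symm z)) = q := by rw [e'.1.left_inv hze', hq]
    by_cases hy : q.1.2 = 0
    · -- a branch point lies only in charts `y`, and the transition between these is the identity
      obtain ⟨e, he⟩ := e
      obtain ⟨e', he'⟩ := e'
      rcases atlas_cases he with ⟨p, hp, rfl⟩ | ⟨p, hp, rfl⟩ | rfl
      · exact absurd hy (y_ne_zero_of_xChartExt_symm hze hq)
      · rcases atlas_cases he' with ⟨p', hp', rfl⟩ | ⟨p', hp', rfl⟩ | rfl
        · exact absurd hy (y_ne_zero_of_xChartExt_symm hzt hq')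
        · rw [deriv_transition_yChartExt hze h, deriv_yCoord_yChartExt_symm,
            monomialForm_yChartExt k he hze hq, monomialForm_yChartExt k he' hzt hq', mul_one]
        · exact absurd hy (y_ne_zero_of_inftyChart_symm hzt hq')
      · exact absurd hy (y_ne_zero_of_inftyChart_symm hze hq)
    · rw [monomialForm_of_y_ne_zero k e hze hq hy, monomialForm_of_y_ne_zero k e' hzt hq' hy,
        mul_assoc]
      congr 1
      have hX : DifferentiableAt ℂ (fun w => xCoord (e'.1.symm w)) (e'.1 (e.1.symm z)) :=
        differentiableAt_xCoord_symm e'.2 hzt (by rw [hq']; exact OnePoint.coe_ne_infty q)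
      have hT := differentiableAt_transition e.2 e'.2 hz
      have h2 := hX.hasDerivAt.comp z hT.hasDerivAt
      rw [← h2.deriv]
      refine EventuallyEq.deriv_eq ?_
      filter_upwards [(e.1.symm.trans e'.1).open_source.mem_nhds hz] with w hw
      exact congrArg xCoord (e'.1.left_inv hw.2).symm

theorem monomialForm_mem {k : ℕ} (hk : k < g) :
    monomialForm g k ∈ holomorphicOneForms (HyperellipticCurve g) :=
  ⟨differentiableOn_monomialForm hk, fun _ _ hz => if_neg hz,
    fun e e' _ hz => monomialForm_transition k e e' hz⟩

theorem formRatio_monomialForm {k : ℕ} (hk : k < g) (q : AffineCurve g) :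
    formRatio g ⟨monomialForm g k, monomialForm_mem hk⟩ q = q.1.1 ^ k := by
  have hz := mem_chart_target ℂ (q : HyperellipticCurve g)
  have hq := (chartAt ℂ (q : HyperellipticCurve g)).left_inv (mem_chart_source ℂ _)
  by_cases hy : q.1.2 = 0
  · have hx := x_ne_zero_of_y_eq_zero hy
    have h3 : (2 * (g : ℂ) + 1) ≠ 0 := by exact_mod_cast Nat.succ_ne_zero (2 * g)
    have he : yChartExt q hx ∈ atlas ℂ (HyperellipticCurve g) :=
      chartAt_of_y_eq_zero hy ▸ chart_mem_atlas ℂ _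
    rw [chartAt_of_y_eq_zero hy] at hz hq
    rw [formRatio_eq_of_yChartExt _ he hz hq]
    change monomialForm g k ⟨yChartExt q hx, he⟩ _ * _ = _
    rw [monomialForm_yChartExt k he hz hq]
    field_simp
  · rw [chartAt_of_y_ne_zero hy] at hz hq
    have h1 := form_eq_of_y_ne_zero ⟨monomialForm g k, monomialForm_mem hk⟩
      ⟨xChartExt q hy, xChartExt_mem_atlas hy⟩ hz hq hy
    have h2 := monomialForm_of_y_ne_zero k ⟨xChartExt q hy, xChartExt_mem_atlas hy⟩ hz hq hy
    rw [deriv_xCoord_xChartExt_symm, mul_one] at h1 h2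
    exact (div_left_inj' hy).1 (h1.symm.trans h2)

/-- A polynomial in `x` as a function on the affine curve. -/
noncomputable def evalX (g : ℕ) : Polynomial ℂ →ₗ[ℂ] (AffineCurve g → ℂ) :=
  LinearMap.pi fun q => Polynomial.leval q.1.1

theorem evalX_apply (P : Polynomial ℂ) (q : AffineCurve g) : evalX g P q = P.eval q.1.1 := rfl

theorem injective_evalX (g : ℕ) : Function.Injective (evalX g) := fun _ _ h =>
  Polynomial.funext fun x => congrFun h (sqrtPoint g x)

theorem range_formRatio (hg : 1 ≤ g) :
    LinearMap.range (formRatio g) = (Polynomial.degreeLT ℂ g).map (evalX g) := by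
  refine le_antisymm ?_ ?_
  · rintro _ ⟨η, rfl⟩
    obtain ⟨P, hP, h⟩ := exists_polynomial_formRatio hg η
    exact ⟨P, hP, funext fun q => (h q).symm⟩
  · rw [Submodule.map_le_iff_le_comap, Polynomial.degreeLT_eq_span_X_pow, Submodule.span_le]
    intro P hP
    simp only [Finset.coe_image, Finset.coe_range, mem_image, mem_Iio] at hP
    obtain ⟨k, hk, rfl⟩ := hP
    refine ⟨⟨monomialForm g k, monomialForm_mem hk⟩, funext fun q => ?_⟩
    rw [formRatio_monomialForm hk, evalX_apply, Polynomial.eval_pow, Polynomial.eval_X]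

theorem genus_hyperellipticCurve (hg : 1 ≤ g) : genus (HyperellipticCurve g) = g := by
  rw [genus, ← LinearMap.finrank_range_of_inj (injective_formRatio g), range_formRatio hg,
    ← ((Polynomial.degreeLT ℂ g).equivMapOfInjective _ (injective_evalX g)).finrank_eq,
    (Polynomial.degreeLTEquiv ℂ g).finrank_eq, Module.finrank_fin_fun]

end Genus

theorem mainTheorem1 (g : ℕ) (hg : 1 ≤ g) :
    IsBelyiPair (HyperellipticCurve g) (belyiMap g) ∧
    genus (HyperellipticCurve g) = g ∧
    HasDegree (belyiMap g) (2 * g + 1) ∧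
    belyiMap g ⁻¹' {((0 : ℂ) : OnePoint ℂ)} = {(ptZeroNegOne g : HyperellipticCurve g)} ∧
    belyiMap g ⁻¹' {((1 : ℂ) : OnePoint ℂ)} = {(ptZeroOne g : HyperellipticCurve g)} ∧
    belyiMap g ⁻¹' {OnePoint.infty} = {(OnePoint.infty : HyperellipticCurve g)} ∧
    ramificationIndex (belyiMap g) (ptZeroNegOne g : HyperellipticCurve g) = 2 * g + 1 ∧
    ramificationIndex (belyiMap g) (ptZeroOne g : HyperellipticCurve g) = 2 * g + 1 ∧
    ramificationIndex (belyiMap g) (OnePoint.infty : HyperellipticCurve g) = 2 * g + 1 ∧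
    passport (belyiMap g) = ({2 * g + 1}, {2 * g + 1}, {2 * g + 1}) := by
  have h0 : ramificationIndex (belyiMap g) (ptZeroNegOne g : HyperellipticCurve g) = 2 * g + 1 :=
    ramificationIndex_of_x_eq_zero rfl
  have h1 : ramificationIndex (belyiMap g) (ptZeroOne g : HyperellipticCurve g) = 2 * g + 1 :=
    ramificationIndex_of_x_eq_zero rfl
  refine ⟨isBelyiPair_belyiMap g, genus_hyperellipticCurve hg, hasDegree_belyiMap g,
    belyiMap_preimage_zero g, belyiMap_preimage_one g, belyiMap_preimage_infty g, h0, h1,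
    ramificationIndex_infty g, ?_⟩
  rw [passport, ramificationOver_of_preimage_eq_singleton (belyiMap_preimage_zero g),
    ramificationOver_of_preimage_eq_singleton (belyiMap_preimage_one g),
    ramificationOver_of_preimage_eq_singleton (belyiMap_preimage_infty g), h0, h1,
    ramificationIndex_infty]
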